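/- Let $N\ge D$ be positive integers. An $\mathrm{ETF}(D,N)$ is a sequence $\varphi_1,\dots,\varphi_N$ of nonzero vectors of equal norm in $\mathbb{C}^D$ (possibly all real) such that $\sum_{n}|\langle\varphi_n,x\rangle|^2=A\|x\|^2$ for some $A>0$ and all $x\in\mathbb{C}^D$, and such that $|\langle\varphi_n,\varphi_{n'}\rangle|$ is constant over all $n\neq n'$. For integers $K$, $S$ with $S>0$ and $L\in\{1,-1\}$, an $\mathrm{ETF}(D,N)$ with $1<D<N$ is of type $(K,L,S)$ if $D=\frac{S}{K}[S(K-1)+L]$ and $N=(S+L)[S(K-1)+L]$; in particular, the claim that an ETF of type $(K,L,S)$ exists includes the claim that $S$ is an integer. For an integer $K\ge2$, a $K$-GDD is a finite set of more than $K$ vertices with collections of subsets called groups and blocks such that the groups partition the vertices, every block has exactly $K$ elements, and any two distinct vertices either lie in a common group and in no common block, or lie in no common group and in exactly one common block. It is of type $M^U$ if it has exactly $U$ groups, each of cardinality $M$. A $\mathrm{BIBD}(U,K,1)$ is a $K$-GDD of type $1^U$, and a transversal design $\mathrm{TD}(K,M)$ is a $K$-GDD of type $M^K$. **Theorem.** If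 an ETF of type $(K,-1,S)$ exists where $S-1$ divides $K-2$, and a $\mathrm{TD}(K,M)$ exists where $M=S(K-1)-1$, then an ETF of type $\left(K,-1,\frac{MU+1}{K-1}\right)$ exists when any of the following holds: (i) $U=1$ or $U=K$; (ii) a $\mathrm{BIBD}(U,K,1)$ exists; (iii) $U=K^J$ for some $J\ge2$, provided a $\mathrm{TD}(K,MK^j)$ exists for all $j=1,\dots,J-1$. Moreover, an ETF of type $(K,-1,S)$ exists in each of the following cases: (a) $K=6$, $S=\frac15(9U+1)$, where either $U=6^J$ for some integer $J\ge0$ or a $\mathrm{BIBD}(U,6,1)$ exists; (b) $K=6$, $S=\frac15(24U+1)$, where either $U=6^J$ for some integer $J\ge0$ or a $\mathrm{BIBD}(U,6,1)$ exists; (c) $K=7$, $S=\frac16(35U+1)$, where either $U=7^J$ for some integer $J\ge0$ or a $\mathrm{BIBD}(U,7,1)$ exists; (d) $K=10$, $S=\frac19(80U+1)$, where either $U=10^J$ for some integer $J\ge0$ or a $\mathrm{BIBD}(U,10,1)$ exists; (e) $K=12$, $S=\frac1{11}(32U+1)$, where either $U=12^J$ for some integer $J\ge0$ or a $\mathrm{BIBD}(U,12,1)$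 exists. -/

import Mathlib

/-- The vectors `φ 0, …, φ (N - 1)` form an equiangular tight frame `ETF(D, N)` for `𝕜 ^ D`:
they form a tight frame, they are nonzero with equal norms, and the moduli of the inner products
of distinct vectors are constant. -/
def IsETF {𝕜 : Type*} [RCLike 𝕜] {D N : ℕ} (φ : Fin N → EuclideanSpace 𝕜 (Fin D)) : Prop :=
  (∃ A : ℝ, 0 < A ∧ ∀ x : EuclideanSpace 𝕜 (Fin D), A * ‖x‖ ^ 2 = ∑ n, ‖inner 𝕜 (φ n) x‖ ^ 2) ∧
  (∃ C : ℝ, 0 < C ∧ ∀ n, ‖φ n‖ ^ 2 = C) ∧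
  (∃ c : ℝ, ∀ n n', n ≠ n' → ‖inner 𝕜 (φ n) (φ n')‖ = c)

/-- The pair `(D, N)`, where `1 < D < N`, is of type `(K, L, S)`; here `K` and `S` are integers,
`S` is positive, and `L` is `1` or `-1`. (No such pair exists when `K ≤ 0`; in particular the
value of the division at `K = 0` is irrelevant because `1 < D`.) -/
def IsETFType (D N : ℕ) (K L S : ℤ) : Prop :=
  1 < D ∧ D < N ∧ (L = 1 ∨ L = -1) ∧ 0 < S ∧
  (D : ℚ) = (S : ℚ) / K * (S * (K - 1) + L) ∧
  (N : ℤ) = (S + L) * (S * (K - 1) + L)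

/-- A (possibly complex) equiangular tight frame of type `(K, L, S)` exists. -/
def ETFOfTypeExists (K L S : ℤ) : Prop :=
  ∃ D N : ℕ, IsETFType D N K L S ∧ ∃ φ : Fin N → EuclideanSpace ℂ (Fin D), IsETF φ

/-- `groups` and `blocks` make the finite vertex set `V` into a `K`-GDD (group divisible design):
`K ≥ 2`, there are more than `K` vertices, the groups partition `V`, every block has `K` elements,
and any two distinct vertices are either in a common group and in no common block,
or in no common group and in exactly one common block. -/
structure IsGDD {V : Type*} [Fintype V] [DecidableEq V] (K : ℕ)
    (groups : Finpartition (Finset.univ : Finset V)) (blocks : Finset (Finset V)) : Prop where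
  two_le : 2 ≤ K
  lt_card : K < Fintype.card V
  card_block : ∀ b ∈ blocks, b.card = K
  pair : ∀ v w : V, v ≠ w →
    ((∃ g ∈ groups.parts, v ∈ g ∧ w ∈ g) ∧ ¬ ∃ b ∈ blocks, v ∈ b ∧ w ∈ b) ∨
    ((¬ ∃ g ∈ groups.parts, v ∈ g ∧ w ∈ g) ∧ ∃! b, b ∈ blocks ∧ v ∈ b ∧ w ∈ b)

/-- A `K`-GDD of type `M ^ U` exists: one with exactly `U` groups, each of cardinality `M`. -/
def UniformGDDExists (K M U : ℕ) : Prop :=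
  ∃ (V : Type) (_ : Fintype V) (_ : DecidableEq V)
    (groups : Finpartition (Finset.univ : Finset V)) (blocks : Finset (Finset V)),
    IsGDD K groups blocks ∧ groups.parts.card = U ∧ ∀ g ∈ groups.parts, g.card = M

/-- A `BIBD(U, K, 1)` exists: a `K`-GDD of type `1 ^ U`. -/
def BIBDExists (U K : ℕ) : Prop := UniformGDDExists K 1 U

/-- A transversal design `TD(K, M)` exists: a `K`-GDD of type `M ^ K`. -/
def TDExists (K M : ℕ) : Prop := UniformGDDExists K M K

/-- An orthogonal array of strength two and index one with columns `ι` and symbols `P` exists. -/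
def OrthogonalArrayExists (ι P : Type) : Prop :=
  ∃ (B : Type) (_ : Finite B) (r : B → ι → P),
    ∀ i j, i ≠ j → ∀ x y, ∃! b, r b i = x ∧ r b j = y

namespace OrthogonalArrayExists

theorem restrict {ι κ P : Type} (h : OrthogonalArrayExists κ P) (f : ι ↪ κ) :
    OrthogonalArrayExists ι P := by
  obtain ⟨B, hB, r, hr⟩ := h
  exact ⟨B, hB, fun b i => r b (f i), fun i j hij x y => hr _ _ (f.injective.ne hij) x y⟩

theorem congr {ι P Q : Type} (h : OrthogonalArrayExists ι P) (e : P ≃ Q) :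
    OrthogonalArrayExists ι Q := by
  obtain ⟨B, hB, r, hr⟩ := h
  refine ⟨B, hB, fun b i => e (r b i), fun i j hij x y => ?_⟩
  simpa [← Equiv.eq_symm_apply] using hr i j hij (e.symm x) (e.symm y)

theorem prod {ι P Q : Type} (h : OrthogonalArrayExists ι P) (h' : OrthogonalArrayExists ι Q) :
    OrthogonalArrayExists ι (P × Q) := by
  obtain ⟨B, hB, r, hr⟩ := h
  obtain ⟨B', hB', r', hr'⟩ := h'
  refine ⟨B × B', inferInstance, fun b i => (r b.1 i, r' b.2 i), ?_⟩
  rintro i j hij ⟨x, x'⟩ ⟨y, y'⟩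
  obtain ⟨b, hb, hu⟩ := hr i j hij x y
  obtain ⟨b', hb', hu'⟩ := hr' i j hij x' y'
  refine ⟨(b, b'), by simp [hb, hb'], ?_⟩
  rintro ⟨c, c'⟩ hc
  simp only [Prod.mk.injEq] at hc
  rw [hu c ⟨hc.1.1, hc.2.1⟩, hu' c' ⟨hc.1.2, hc.2.2⟩]

/-- The lines of the affine plane over a finite field. -/
theorem of_field (F : Type) [Field F] [Finite F] : OrthogonalArrayExists (Option F) F := by
  refine ⟨F × F, inferInstance, fun b i => i.elim b.1 (fun s => b.1 * s + b.2), ?_⟩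
  rintro (_ | s) (_ | t) hij x y
  · exact absurd rfl hij
  · refine ⟨(x, y - x * t), by simp, ?_⟩
    rintro ⟨a, b⟩ ⟨h₁, h₂⟩
    simp only [Option.elim] at h₁ h₂
    subst h₁
    rw [← h₂]; simp
  · refine ⟨(y, x - y * s), by simp, ?_⟩
    rintro ⟨a, b⟩ ⟨h₁, h₂⟩
    simp only [Option.elim] at h₁ h₂
    subst h₂
    rw [← h₁]; simp
  · have hst : s - t ≠ 0 := sub_ne_zero.2 fun h => hij (by rw [h])
    refine ⟨((x - y) / (s - t), x - (x - y) / (s - t) * s), ⟨by simp, ?_⟩, ?_⟩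
    · simp only [Option.elim]
      field_simp
      ring
    · rintro ⟨a, b⟩ ⟨h₁, h₂⟩
      simp only [Option.elim] at h₁ h₂
      have : a = (x - y) / (s - t) := by
        rw [eq_div_iff hst, ← h₁, ← h₂]; ring
      rw [← this, ← h₁]; simp

/-- The orthogonal array developed from a difference matrix. -/
theorem of_differenceMatrix {ι G : Type} [AddGroup G] [Finite G] (m : ι → G → G)
    (hm : ∀ i j, i ≠ j → Function.Bijective fun c => m i c - m j c) :
    OrthogonalArrayExists (Option ι) G := by
  refine ⟨G × G, inferInstance, fun b i => i.elim b.1 (fun s => m s b.1 + b.2), ?_⟩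
  rintro (_ | s) (_ | t) hij x y
  · exact absurd rfl hij
  · refine ⟨(x, -m t x + y), by simp, ?_⟩
    rintro ⟨a, b⟩ ⟨h₁, h₂⟩
    simp only [Option.elim] at h₁ h₂
    subst h₁
    rw [← h₂]; simp
  · refine ⟨(y, -m s y + x), by simp, ?_⟩
    rintro ⟨a, b⟩ ⟨h₁, h₂⟩
    simp only [Option.elim] at h₁ h₂
    subst h₂
    rw [← h₁]; simp
  · have hst : s ≠ t := fun h => hij (by rw [h])
    obtain ⟨c, hc⟩ := (hm s t hst).2 (x - y)
    simp only at hc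
    refine ⟨(c, -m s c + x), ⟨by simp, ?_⟩, ?_⟩
    · simp only [Option.elim]
      have : x = m s c - m t c + y := by rw [hc]; simp
      rw [this]; simp [sub_eq_add_neg, add_assoc]
    · rintro ⟨a, b⟩ ⟨h₁, h₂⟩
      simp only [Option.elim] at h₁ h₂
      have : a = c := (hm s t hst).1 (by simp only [hc, ← h₁, ← h₂]; simp)
      subst this
      rw [← h₁]; simp

theorem exists_base_block {ι X : Type} [Nontrivial ι]
    (h : OrthogonalArrayExists ι (Option X)) :
    ∃ (B : Type) (_ : Finite B) (b₀ : B) (r : B → ι → Option X),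
      (∀ i, r b₀ i = none) ∧ ∀ i j, i ≠ j → ∀ x y, ∃! b, r b i = x ∧ r b j = y := by
  classical
  obtain ⟨B, hB, r, hr⟩ := h
  obtain ⟨i, j, hij⟩ := exists_pair_ne ι
  obtain ⟨b₀, -, -⟩ := hr i j hij none none
  refine ⟨B, hB, b₀, fun b i => Equiv.swap (r b₀ i) none (r b i), by simp, ?_⟩
  intro i j hij x y
  simpa [← Equiv.eq_symm_apply] using
    hr i j hij (Equiv.swap (r b₀ i) none x) (Equiv.swap (r b₀ j) none y)

/-- Wilson's construction: truncate one column of the master array `h` to the subtype `p`. -/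
theorem wilson {ι T X : Type} [Nontrivial ι] (p : T → Prop)
    (h : OrthogonalArrayExists (Option ι) T) (h₁ : OrthogonalArrayExists ι X)
    (h₂ : OrthogonalArrayExists ι (Option X)) (h₃ : OrthogonalArrayExists ι {t // p t}) :
    OrthogonalArrayExists ι ((T × X) ⊕ {t // p t}) := by
  classical
  obtain ⟨B, hB, r, hr⟩ := h
  obtain ⟨B₁, hB₁, r₁, hr₁⟩ := h₁
  obtain ⟨B₂, hB₂, b₀, r₂, hb₀, hr₂⟩ := h₂.exists_base_block
  obtain ⟨B₃, hB₃, r₃, hr₃⟩ := h₃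
  refine ⟨({b // ¬ p (r b none)} × B₁) ⊕ ({b // p (r b none)} × {b // b ≠ b₀}) ⊕ B₃,
    inferInstance, fun b i => match b with
      | .inl (b, c) => .inl (r b (some i), r₁ c i)
      | .inr (.inl (b, c)) => (r₂ c i).elim (.inr ⟨r b none, b.2⟩) (fun x => .inl (r b (some i), x))
      | .inr (.inr c) => .inr (r₃ c i), ?_⟩
  have key : ∀ (o : Option X) (t : T) (u : {t // p t}) (z : T × X),
      (o.elim (Sum.inr u) (fun x => Sum.inl (t, x)) : (T × X) ⊕ {t // p t}) = .inl z ↔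
        o = some z.2 ∧ t = z.1 := by
    rintro (_ | o) t u ⟨z, z'⟩ <;> simp [and_comm]
  have key' : ∀ (o : Option X) (t : T) (u u' : {t // p t}),
      (o.elim (Sum.inr u) (fun x => Sum.inl (t, x)) : (T × X) ⊕ {t // p t}) = .inr u' ↔
        o = none ∧ u = u' := by
    rintro (_ | o) t u u' <;> simp
  have mixed : ∀ (i j : ι), i ≠ j → ∀ (t : T) (x : X) (u : {t // p t}),
      ∃ b : B, ∃ hb : p (r b none), ∃ c : {b // b ≠ b₀}, r b (some i) = t ∧ r b none = u ∧
        r₂ c i = some x ∧ r₂ c j = none := by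
    intro i j hij t x u
    obtain ⟨b, ⟨hb, hb'⟩, -⟩ := hr (some i) none (by simp) t u
    obtain ⟨c, ⟨hc, hc'⟩, -⟩ := hr₂ i j hij (some x) none
    exact ⟨b, hb' ▸ u.2, ⟨c, fun h => by simp [h, hb₀] at hc⟩, hb, hb', hc, hc'⟩
  intro i j hij v w
  have hij' : (some i : Option ι) ≠ some j := by simpa using hij
  rcases v with ⟨t, x⟩ | u <;> rcases w with ⟨t', x'⟩ | u'
  · obtain ⟨b, ⟨hb, hb'⟩, hbu⟩ := hr (some i) (some j) hij' t t'
    by_cases hp : p (r b none)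
    · obtain ⟨c, ⟨hc, hc'⟩, hcu⟩ := hr₂ i j hij (some x) (some x')
      refine ⟨.inr (.inl (⟨b, hp⟩, ⟨c, fun h => by simp [h, hb₀] at hc⟩)),
        by simp [hb, hb', hc, hc'], ?_⟩
      rintro (⟨⟨d, hd⟩, e⟩ | ⟨⟨d, hd⟩, ⟨e, he⟩⟩ | e) ⟨h₁, h₂⟩
      · simp only [Sum.inl.injEq, Prod.mk.injEq] at h₁ h₂
        obtain rfl := hbu d ⟨h₁.1, h₂.1⟩
        exact absurd hp hd
      · simp only [key] at h₁ h₂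
        obtain rfl := hbu d ⟨h₁.2, h₂.2⟩
        obtain rfl := hcu e ⟨h₁.1, h₂.1⟩
        rfl
      · simp at h₁
    · obtain ⟨c, ⟨hc, hc'⟩, hcu⟩ := hr₁ i j hij x x'
      refine ⟨.inl (⟨b, hp⟩, c), by simp [hb, hb', hc, hc'], ?_⟩
      rintro (⟨⟨d, hd⟩, e⟩ | ⟨⟨d, hd⟩, ⟨e, he⟩⟩ | e) ⟨h₁, h₂⟩
      · simp only [Sum.inl.injEq, Prod.mk.injEq] at h₁ h₂
        obtain rfl := hbu d ⟨h₁.1, h₂.1⟩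
        obtain rfl := hcu e ⟨h₁.2, h₂.2⟩
        rfl
      · simp only [key] at h₁ h₂
        obtain rfl := hbu d ⟨h₁.2, h₂.2⟩
        exact absurd hd hp
      · simp at h₁
  · obtain ⟨b, hb, c, h₁, h₂, h₃, h₄⟩ := mixed i j hij t x u'
    refine ⟨.inr (.inl (⟨b, hb⟩, c)), by simp [h₁, h₂, h₃, h₄], ?_⟩
    rintro (⟨⟨d, hd⟩, e⟩ | ⟨⟨d, hd⟩, e⟩ | e) ⟨g₁, g₂⟩
    · simp at g₂
    · simp only [key, key'] at g₁ g₂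
      obtain rfl := (hr (some i) none (by simp) t u').unique ⟨g₁.2, congrArg Subtype.val g₂.2⟩
        ⟨h₁, h₂⟩
      obtain rfl := Subtype.ext ((hr₂ i j hij (some x) none).unique ⟨g₁.1, g₂.1⟩ ⟨h₃, h₄⟩)
      rfl
    · simp at g₁
  · obtain ⟨b, hb, c, h₁, h₂, h₃, h₄⟩ := mixed j i hij.symm t' x' u
    refine ⟨.inr (.inl (⟨b, hb⟩, c)), by simp [h₁, h₂, h₃, h₄], ?_⟩
    rintro (⟨⟨d, hd⟩, e⟩ | ⟨⟨d, hd⟩, e⟩ | e) ⟨g₂, g₁⟩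
    · simp at g₂
    · simp only [key, key'] at g₁ g₂
      obtain rfl := (hr (some j) none (by simp) t' u).unique ⟨g₁.2, congrArg Subtype.val g₂.2⟩
        ⟨h₁, h₂⟩
      obtain rfl := Subtype.ext
        ((hr₂ j i hij.symm (some x') none).unique ⟨g₁.1, g₂.1⟩ ⟨h₃, h₄⟩)
      rfl
    · simp at g₁
  · obtain ⟨c, ⟨hc, hc'⟩, hcu⟩ := hr₃ i j hij u u'
    refine ⟨.inr (.inr c), by simp [hc, hc'], ?_⟩
    rintro (⟨⟨d, hd⟩, e⟩ | ⟨⟨d, hd⟩, ⟨e, he⟩⟩ | e) ⟨g₁, g₂⟩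
    · simp at g₁
    · simp only [key'] at g₁ g₂
      exact absurd ((hr₂ i j hij none none).unique ⟨g₁.1, g₂.1⟩ ⟨hb₀ i, hb₀ j⟩) he
    · simp only [Sum.inr.injEq] at g₁ g₂
      rw [hcu e ⟨g₁, g₂⟩]

theorem of_primePow {k p n : ℕ} (hp : p.Prime) (hn : n ≠ 0) (hk : k ≤ p ^ n + 1) :
    OrthogonalArrayExists (Fin k) (Fin (p ^ n)) := by
  have := Fact.mk hp
  have : Fintype (GaloisField p n) := Fintype.ofFinite _
  have hc : Fintype.card (GaloisField p n) = p ^ n := by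
    rw [← Nat.card_eq_fintype_card, GaloisField.card p n hn]
  obtain ⟨f⟩ : Nonempty (Fin k ↪ Option (GaloisField p n)) :=
    Function.Embedding.nonempty_of_card_le (by simpa [hc] using hk)
  exact ((of_field (GaloisField p n)).restrict f).congr (Fintype.equivFinOfCardEq hc)

theorem of_prime {k p : ℕ} (hp : p.Prime) (hk : k ≤ p + 1) :
    OrthogonalArrayExists (Fin k) (Fin p) := by
  have := of_primePow (n := 1) hp one_ne_zero (by simpa using hk)
  rwa [pow_one] at this

theorem mul {k m n : ℕ} (h : OrthogonalArrayExists (Fin k) (Fin m))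
    (h' : OrthogonalArrayExists (Fin k) (Fin n)) :
    OrthogonalArrayExists (Fin k) (Fin (m * n)) :=
  (h.prod h').congr finProdFinEquiv

theorem wilson_fin {k t m u : ℕ} (hk : 2 ≤ k) (hu : u ≤ t)
    (h : OrthogonalArrayExists (Fin (k + 1)) (Fin t))
    (h₁ : OrthogonalArrayExists (Fin k) (Fin m))
    (h₂ : OrthogonalArrayExists (Fin k) (Fin (m + 1)))
    (h₃ : OrthogonalArrayExists (Fin k) (Fin u)) :
    OrthogonalArrayExists (Fin k) (Fin (t * m + u)) := by
  have : Nontrivial (Fin k) := Fin.nontrivial_iff_two_le.2 hk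
  have e : Fin u ≃ {x : Fin t // x.val < u} :=
    ⟨fun x => ⟨⟨x, by omega⟩, x.2⟩, fun x => ⟨x.1, x.2⟩, fun x => rfl, fun x => rfl⟩
  refine (wilson (fun x : Fin t => x.val < u) (h.restrict (finSuccEquiv k).symm.toEmbedding) h₁
    (h₂.congr (finSuccEquiv m)) (h₃.congr e)).congr ?_
  exact (Equiv.sumCongr finProdFinEquiv e.symm).trans finSumFinEquiv

end OrthogonalArrayExists

/-- The elementary abelian group of bit vectors under bitwise exclusive or. -/
def XorVec (c : ℕ) : Type := BitVec c

namespace XorVec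

instance (c : ℕ) : Add (XorVec c) := ⟨fun x y => BitVec.xor x y⟩
instance (c : ℕ) : Zero (XorVec c) := ⟨BitVec.zero c⟩
instance (c : ℕ) : Neg (XorVec c) := ⟨fun x => x⟩

instance (c : ℕ) : AddGroup (XorVec c) :=
  AddGroup.ofLeftAxioms (fun x y z => BitVec.xor_assoc x y z) (fun _ => BitVec.zero_xor)
    (fun _ => BitVec.xor_self)

/-- Bit vectors of length `c` are numbered by `Fin (2 ^ c)`. -/
def equivFin (c : ℕ) : XorVec c ≃ Fin (2 ^ c) where
  toFun x := BitVec.toFin x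
  invFun x := BitVec.ofFin x
  left_inv _ := rfl
  right_inv _ := rfl

instance (c : ℕ) : Fintype (XorVec c) := Fintype.ofEquiv _ (equivFin c).symm

theorem card (c : ℕ) : Fintype.card (XorVec c) = 2 ^ c := by
  rw [Fintype.card_congr (equivFin c), Fintype.card_fin]

/-- The vector of the `c` lowest binary digits of a number. -/
def ofNat (c x : ℕ) : XorVec c := BitVec.ofNat c x

theorem ofNat_sub (c x y : ℕ) : ofNat c x - ofNat c y = ofNat c (x ^^^ y) := by
  rw [sub_eq_add_neg]
  exact (BitVec.ofNat_xor).symm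

theorem ofNat_surjective {c : ℕ} (x : XorVec c) : ∃ n < 2 ^ c, ofNat c n = x :=
  ⟨BitVec.toNat x, BitVec.isLt x, BitVec.eq_of_toNat_eq
    ((BitVec.toNat_ofNat _ _).trans (Nat.mod_eq_of_lt (BitVec.isLt x)))⟩

end XorVec

/-- The number `2 ^ c * a + x` with `x < 2 ^ c` encodes the pair of `a` modulo `m` and the binary
digits of `x`. -/
def decodePair (m c n : ℕ) : ZMod m × XorVec c := ((n / 2 ^ c : ℕ), XorVec.ofNat c n)

/-- The operation on codes that corresponds to subtraction of pairs. -/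
def codeSub (m c x y : ℕ) : ℕ :=
  2 ^ c * ((x / 2 ^ c + (m - y / 2 ^ c)) % m) + (x ^^^ y) % 2 ^ c

theorem decodePair_codeSub {m c x y : ℕ} (hy : y < m * 2 ^ c) :
    decodePair m c (codeSub m c x y) = decodePair m c x - decodePair m c y := by
  have h2 : 0 < 2 ^ c := by positivity
  have hy' : y / 2 ^ c ≤ m := (Nat.div_lt_of_lt_mul (by rwa [mul_comm])).le
  refine Prod.ext ?_ ?_
  · simp only [decodePair, codeSub, Prod.fst_sub]
    rw [Nat.mul_add_div h2, Nat.div_eq_of_lt (Nat.mod_lt _ h2), add_zero, ZMod.natCast_mod,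
      Nat.cast_add, Nat.cast_sub hy']
    simp [sub_eq_add_neg]
  · simp only [decodePair, codeSub, Prod.snd_sub, XorVec.ofNat_sub]
    simp only [XorVec.ofNat]
    apply BitVec.eq_of_toNat_eq
    simp [BitVec.toNat_ofNat, Nat.xor_mod_two_pow]

theorem exists_decodePair {m c : ℕ} [NeZero m] (g : ZMod m × XorVec c) :
    ∃ n < m * 2 ^ c, decodePair m c n = g := by
  obtain ⟨a, x⟩ := g
  obtain ⟨k, hk, rfl⟩ := XorVec.ofNat_surjective x
  have h2 : 0 < 2 ^ c := by positivity
  have ha := ZMod.val_lt a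
  refine ⟨2 ^ c * a.val + k, by nlinarith, ?_⟩
  refine Prod.ext ?_ ?_
  · simp only [decodePair]
    rw [Nat.mul_add_div h2, Nat.div_eq_of_lt hk, add_zero, ZMod.natCast_val, ZMod.cast_id]
  · simp only [decodePair, XorVec.ofNat]
    apply BitVec.eq_of_toNat_eq
    simp [BitVec.toNat_ofNat]

/-- The bit mask of the set of code differences of two rows. -/
def differenceMask (m c : ℕ) : List ℕ → List ℕ → ℕ
  | x :: l, y :: l' => differenceMask m c l l' ||| 1 <<< codeSub m c x y
  | _, _ => 0

theorem exists_of_testBit_differenceMask {m c n : ℕ} : ∀ {l l' : List ℕ},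
    (differenceMask m c l l').testBit n →
      ∃ s, s < l.length ∧ codeSub m c (l.getD s 0) (l'.getD s 0) = n
  | [], _, h => by simp [differenceMask] at h
  | _ :: _, [], h => by simp [differenceMask] at h
  | x :: l, y :: l', h => by
    rw [differenceMask, Nat.testBit_or, Bool.or_eq_true] at h
    rcases h with h | h
    · obtain ⟨s, hs, hs'⟩ := exists_of_testBit_differenceMask h
      exact ⟨s + 1, by simpa using hs, by simpa using hs'⟩
    · rw [Nat.one_shiftLeft, Nat.testBit_two_pow, decide_eq_true_iff] at h
      exact ⟨0, by simp, by simpa using h⟩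

/-- `D` is a list of codes of the rows of a difference matrix. -/
def IsDifferenceTable (m c : ℕ) (D : List (List ℕ)) : Prop :=
  (∀ l ∈ D, l.length = m * 2 ^ c ∧ ∀ x ∈ l, x < m * 2 ^ c) ∧
    D.Pairwise fun l l' => differenceMask m c l l' = 2 ^ (m * 2 ^ c) - 1

instance (m c : ℕ) (D : List (List ℕ)) : Decidable (IsDifferenceTable m c D) :=
  inferInstanceAs (Decidable (_ ∧ _))

theorem OrthogonalArrayExists.of_differenceTable {m c : ℕ} [NeZero m] {D : List (List ℕ)}
    (hD : IsDifferenceTable m c D) :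
    OrthogonalArrayExists (Fin (D.length + 1)) (Fin (m * 2 ^ c)) := by
  have hcard : Fintype.card (ZMod m × XorVec c) = m * 2 ^ c := by
    rw [Fintype.card_prod, ZMod.card, XorVec.card]
  let e : ZMod m × XorVec c ≃ Fin (m * 2 ^ c) := Fintype.equivFinOfCardEq hcard
  let f : Fin D.length → ZMod m × XorVec c → ZMod m × XorVec c :=
    fun i g => decodePair m c ((D.get i).getD (e g) 0)
  have hlt : ∀ i j, i < j → Function.Surjective fun g => f i g - f j g := by
    intro i j hij g
    obtain ⟨n, hn, rfl⟩ := exists_decodePair g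
    have hb : (differenceMask m c (D.get i) (D.get j)).testBit n := by
      rw [List.pairwise_iff_get.1 hD.2 i j hij, Nat.testBit_two_pow_sub_one]
      simpa using hn
    obtain ⟨s, hs, rfl⟩ := exists_of_testBit_differenceMask hb
    have hi := hD.1 _ (D.get_mem i)
    have hj := hD.1 _ (D.get_mem j)
    have hs' : s < (D.get j).length := by omega
    refine ⟨e.symm ⟨s, by omega⟩, ?_⟩
    simp only [f, Equiv.apply_symm_apply]
    rw [decodePair_codeSub]
    rw [List.getD_eq_getElem _ _ hs']
    exact hj.2 _ (List.getElem_mem _)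
  have hbij : ∀ i j, i ≠ j → Function.Bijective fun g => f i g - f j g := by
    intro i j hij
    rw [← Finite.surjective_iff_bijective]
    rcases lt_or_gt_of_ne hij with h | h
    · exact hlt i j h
    · intro g
      obtain ⟨x, hx⟩ := hlt j i h (-g)
      refine ⟨x, ?_⟩
      simp only at hx ⊢
      rw [← neg_sub (f j x) (f i x)]
      rw [hx, neg_neg]
  exact ((OrthogonalArrayExists.of_differenceMatrix f hbij).restrict
    (finSuccEquiv D.length).toEmbedding).congr e

/-- A difference matrix with 5 rows over `ℤ / 3 × (ℤ / 2) ^ 2`. -/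
def differenceTable12 : List (List ℕ) :=
  [[0, 0, 0, 0, 0, 0, 0, 0, 0, 0, 0, 0],
   [0, 1, 2, 3, 4, 5, 6, 7, 8, 9, 10, 11],
   [0, 2, 7, 8, 5, 11, 9, 3, 10, 1, 4, 6],
   [0, 9, 4, 10, 8, 3, 7, 5, 11, 6, 1, 2],
   [0, 10, 6, 5, 9, 4, 2, 1, 3, 11, 7, 8]]

set_option maxRecDepth 10000 in
theorem OrthogonalArrayExists.of_order_12 : OrthogonalArrayExists (Fin 6) (Fin 12) :=
  of_differenceTable (m := 3) (c := 2) (D := differenceTable12) (by decide +kernel)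

/-- A difference matrix with 5 rows over `ℤ / 3 × (ℤ / 2) ^ 3`. -/
def differenceTable24 : List (List ℕ) :=
  [[0, 0, 0, 0, 0, 0, 0, 0, 0, 0, 0, 0, 0, 0, 0, 0, 0, 0, 0, 0, 0, 0, 0, 0],
   [0, 1, 2, 3, 4, 5, 6, 7, 8, 9, 10, 11, 12, 13, 14, 15, 16, 17, 18, 19, 20, 21, 22, 23],
   [0, 2, 4, 6, 8, 10, 12, 14, 1, 3, 5, 7, 20, 22, 16, 18, 13, 15, 9, 11, 19, 17, 23, 21],
   [0, 3, 6, 5, 12, 15, 10, 9, 17, 18, 23, 20, 4, 7, 2, 1, 19, 16, 21, 22, 13, 14, 11, 8],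
   [0, 4, 3, 7, 16, 20, 19, 23, 10, 14, 9, 13, 22, 18, 21, 17, 1, 5, 2, 6, 11, 15, 8, 12]]

set_option maxRecDepth 10000 in
theorem OrthogonalArrayExists.of_order_24 : OrthogonalArrayExists (Fin 6) (Fin 24) :=
  of_differenceTable (m := 3) (c := 3) (D := differenceTable24) (by decide +kernel)

/-- A difference matrix with 9 rows over `ℤ / 5 × (ℤ / 2) ^ 4`. -/
def differenceTable80 : List (List ℕ) :=
  [[0, 0, 0, 0, 0, 0, 0, 0, 0, 0, 0, 0, 0, 0, 0, 0, 0, 0, 0, 0, 0, 0, 0, 0, 0, 0, 0, 0, 0, 0, 0,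
    0, 0, 0, 0, 0, 0, 0, 0, 0, 0, 0, 0, 0, 0, 0, 0, 0, 0, 0, 0, 0, 0, 0, 0, 0, 0, 0, 0, 0, 0, 0,
    0, 0, 0, 0, 0, 0, 0, 0, 0, 0, 0, 0, 0, 0, 0, 0, 0, 0],
   [0, 1, 2, 3, 4, 5, 6, 7, 8, 9, 10, 11, 12, 13, 14, 15, 16, 17, 18, 19, 20, 21, 22, 23, 24, 25,
    26, 27, 28, 29, 30, 31, 32, 33, 34, 35, 36, 37, 38, 39, 40, 41, 42, 43, 44, 45, 46, 47, 48,
    49, 50, 51, 52, 53, 54, 55, 56, 57, 58, 59, 60, 61, 62, 63, 64, 65, 66, 67, 68, 69, 70, 71,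
    72, 73, 74, 75, 76, 77, 78, 79],
   [0, 5, 10, 15, 39, 34, 45, 40, 14, 11, 4, 1, 41, 44, 35, 38, 32, 37, 42, 47, 73, 76, 67, 70,
    46, 43, 36, 33, 71, 66, 77, 72, 64, 69, 74, 79, 25, 28, 19, 22, 78, 75, 68, 65, 23, 18, 29,
    24, 16, 21, 26, 31, 57, 60, 51, 54, 30, 27, 20, 17, 55, 50, 61, 56, 48, 53, 58, 63, 9, 12, 3,
    6, 62, 59, 52, 49, 7, 2, 13, 8],
   [0, 4, 8, 12, 19, 23, 27, 31, 6, 2, 14, 10, 21, 17, 29, 25, 48, 52, 56, 60, 77, 73, 69, 65,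
    54, 50, 62, 58, 75, 79, 67, 71, 16, 20, 24, 28, 45, 41, 37, 33, 22, 18, 30, 26, 43, 47, 35,
    39, 64, 68, 72, 76, 13, 9, 5, 1, 70, 66, 78, 74, 11, 15, 3, 7, 32, 36, 40, 44, 61, 57, 53, 49,
    38, 34, 46, 42, 59, 63, 51, 55],
   [0, 3, 6, 5, 44, 47, 42, 41, 11, 8, 13, 14, 39, 36, 33, 34, 64, 67, 70, 69, 30, 29, 24, 27,
    75, 72, 77, 78, 21, 22, 19, 16, 56, 59, 62, 61, 12, 15, 10, 9, 51, 48, 53, 54, 7, 4, 1, 2, 32,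
    35, 38, 37, 66, 65, 68, 71, 43, 40, 45, 46, 73, 74, 79, 76, 20, 23, 18, 17, 60, 63, 58, 57,
    31, 28, 25, 26, 55, 52, 49, 50],
   [0, 15, 13, 2, 75, 68, 70, 73, 1, 14, 12, 3, 74, 69, 71, 72, 36, 43, 41, 38, 8, 7, 5, 10, 37,
    42, 40, 39, 9, 6, 4, 11, 48, 63, 61, 50, 66, 77, 79, 64, 49, 62, 60, 51, 67, 76, 78, 65, 53,
    58, 56, 55, 28, 19, 17, 30, 52, 59, 57, 54, 29, 18, 16, 31, 35, 44, 46, 33, 22, 25, 27, 20,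
    34, 45, 47, 32, 23, 24, 26, 21],
   [0, 8, 3, 11, 73, 65, 74, 66, 12, 4, 15, 7, 69, 77, 70, 78, 56, 48, 59, 51, 40, 32, 43, 35,
    52, 60, 55, 63, 36, 44, 39, 47, 2, 10, 1, 9, 50, 58, 49, 57, 14, 6, 13, 5, 62, 54, 61, 53, 21,
    29, 22, 30, 38, 46, 37, 45, 25, 17, 26, 18, 42, 34, 41, 33, 27, 19, 24, 16, 71, 79, 68, 76,
    23, 31, 20, 28, 75, 67, 72, 64],
   [0, 7, 14, 9, 55, 48, 57, 62, 13, 10, 3, 4, 58, 61, 52, 51, 77, 74, 67, 68, 59, 60, 53, 50,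
    64, 71, 78, 73, 54, 49, 56, 63, 34, 37, 44, 43, 18, 21, 28, 27, 47, 40, 33, 38, 31, 24, 17,
    22, 76, 75, 66, 69, 32, 39, 46, 41, 65, 70, 79, 72, 45, 42, 35, 36, 1, 6, 15, 8, 19, 20, 29,
    26, 12, 11, 2, 5, 30, 25, 16, 23],
   [0, 12, 11, 7, 29, 17, 22, 26, 10, 6, 1, 13, 23, 27, 28, 16, 15, 3, 4, 8, 49, 61, 58, 54, 5,
    9, 14, 2, 59, 55, 48, 60, 79, 67, 68, 72, 53, 57, 62, 50, 69, 73, 78, 66, 63, 51, 52, 56, 37,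
    41, 46, 34, 24, 20, 19, 31, 47, 35, 36, 40, 18, 30, 25, 21, 74, 70, 65, 77, 43, 39, 32, 44,
    64, 76, 75, 71, 33, 45, 42, 38]]

set_option maxRecDepth 10000 in
theorem OrthogonalArrayExists.of_order_80 : OrthogonalArrayExists (Fin 10) (Fin 80) :=
  of_differenceTable (m := 5) (c := 4) (D := differenceTable80) (by decide +kernel)

/-- A difference matrix with 6 rows over `ℤ / 35`. -/
def differenceTable35 : List (List ℕ) :=
  [[0, 0, 0, 0, 0, 0, 0, 0, 0, 0, 0, 0, 0, 0, 0, 0, 0, 0, 0, 0, 0, 0, 0, 0, 0, 0, 0, 0, 0, 0, 0,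
    0, 0, 0, 0],
   [0, 1, 2, 3, 4, 5, 6, 7, 8, 9, 10, 11, 12, 13, 14, 15, 16, 17, 18, 19, 20, 21, 22, 23, 24, 25,
    26, 27, 28, 29, 30, 31, 32, 33, 34],
   [0, 7, 4, 17, 11, 6, 3, 26, 21, 19, 30, 15, 23, 22, 2, 10, 8, 34, 1, 27, 25, 33, 13, 12, 20,
    5, 16, 14, 9, 32, 29, 24, 18, 31, 28],
   [0, 12, 8, 20, 17, 26, 25, 33, 7, 29, 3, 34, 14, 5, 4, 11, 19, 22, 13, 16, 24, 31, 30, 21, 1,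
    32, 6, 28, 2, 10, 9, 18, 15, 27, 23],
   [0, 9, 27, 32, 7, 24, 29, 25, 13, 5, 23, 20, 1, 33, 21, 16, 18, 31, 4, 17, 19, 14, 2, 34, 15,
    12, 30, 22, 10, 6, 11, 28, 3, 8, 26],
   [0, 29, 34, 24, 19, 10, 18, 3, 30, 8, 28, 21, 20, 4, 12, 26, 22, 33, 2, 13, 9, 23, 31, 15, 14,
    7, 27, 5, 32, 17, 25, 16, 11, 1, 6]]

set_option maxRecDepth 10000 in
theorem OrthogonalArrayExists.of_order_35 : OrthogonalArrayExists (Fin 7) (Fin 35) :=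
  of_differenceTable (m := 35) (c := 0) (D := differenceTable35) (by decide +kernel)

/-- A group divisible design with blocks of size `K` exists on the vertices `Γ × P`, the groups
being the fibres of the first projection. -/
def GroupDivisibleExists (K : ℕ) (Γ P : Type) : Prop :=
  ∃ (B : Type) (_ : Fintype B) (blk : B → Finset (Γ × P)), (∀ b, (blk b).card = K) ∧
    (∀ b v w, v ∈ blk b → w ∈ blk b → v.1 = w.1 → v = w) ∧
    ∀ v w, v.1 ≠ w.1 → ∃! b, v ∈ blk b ∧ w ∈ blk b

namespace GroupDivisibleExists

theorem congr {K : ℕ} {Γ P Δ Q : Type} (h : GroupDivisibleExists K Γ P) (e : Γ ≃ Δ) (f : P ≃ Q) :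
    GroupDivisibleExists K Δ Q := by
  obtain ⟨B, hB, blk, h₁, h₂, h₃⟩ := h
  refine ⟨B, hB, fun b => (blk b).map (e.prodCongr f).toEmbedding, fun b => by simp [h₁], ?_, ?_⟩
  · intro b v w hv hw hvw
    rw [Finset.mem_map_equiv] at hv hw
    exact (e.prodCongr f).symm.injective (h₂ b _ _ hv hw (by simp [hvw]))
  · intro v w hvw
    simpa only [Finset.mem_map_equiv] using
      h₃ ((e.prodCongr f).symm v) ((e.prodCongr f).symm w) (by simpa using hvw)

theorem of_subsingleton (K : ℕ) (Γ P : Type) [Subsingleton Γ] : GroupDivisibleExists K Γ P :=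
  ⟨Empty, inferInstance, fun b => b.elim, fun b => b.elim, fun b => b.elim,
    fun v w h => absurd (Subsingleton.elim v.1 w.1) h⟩

theorem of_orthogonalArray {K : ℕ} {P : Type}
    (h : OrthogonalArrayExists (Fin K) P) : GroupDivisibleExists K (Fin K) P := by
  classical
  obtain ⟨B, hB, r, hr⟩ := h
  have := Fintype.ofFinite B
  have hinj : ∀ b, Function.Injective fun i : Fin K => (i, r b i) :=
    fun b i j h => congrArg Prod.fst h
  have hmem : ∀ b (v : Fin K × P),
      v ∈ Finset.univ.map ⟨fun i : Fin K => (i, r b i), hinj b⟩ ↔ r b v.1 = v.2 := by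
    rintro b ⟨i, x⟩
    simp [Prod.ext_iff]
  refine ⟨B, inferInstance, fun b => Finset.univ.map ⟨fun i => (i, r b i), hinj b⟩,
    fun b => by simp, ?_, ?_⟩
  · intro b v w hv hw hvw
    rw [hmem] at hv hw
    exact Prod.ext hvw (by rw [← hv, ← hw, hvw])
  · intro v w hvw
    simp only [hmem]
    exact hr _ _ hvw _ _

theorem of_uniform {K M U : ℕ} (h : UniformGDDExists K M U) :
    GroupDivisibleExists K (Fin U) (Fin M) := by
  classical
  obtain ⟨V, hV, hdec, groups, blocks, hG, hU, hM⟩ := h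
  let γ : Fin U ≃ groups.parts := (Fintype.equivFinOfCardEq (by simpa using hU)).symm
  let ρ : ∀ g : groups.parts, Fin M ≃ g.1 := fun g =>
    (Fintype.equivFinOfCardEq (by simpa using hM g.1 g.2)).symm
  let f : Fin U × Fin M → V := fun v => (ρ (γ v.1) v.2).1
  have hf : ∀ v : Fin U × Fin M, f v ∈ (γ v.1).1 := fun v => (ρ (γ v.1) v.2).2
  have hsame : ∀ v w : Fin U × Fin M,
      (∃ g ∈ groups.parts, f v ∈ g ∧ f w ∈ g) ↔ v.1 = w.1 := by
    intro v w
    constructor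
    · rintro ⟨g, hg, hv, hw⟩
      apply γ.injective
      apply Subtype.ext
      rw [groups.eq_of_mem_parts (γ v.1).2 hg (hf v) hv, groups.eq_of_mem_parts (γ w.1).2 hg (hf w) hw]
    · intro h
      exact ⟨_, (γ v.1).2, hf v, h ▸ hf w⟩
  have hinj : Function.Injective f := by
    intro v w h
    have h₁ : v.1 = w.1 := (hsame v w).1 ⟨_, (γ v.1).2, hf v, h ▸ hf v⟩
    obtain ⟨i, x⟩ := v
    obtain ⟨j, y⟩ := w
    obtain rfl : i = j := h₁
    exact Prod.ext rfl ((ρ (γ i)).injective (Subtype.ext h))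
  have hsurj : Function.Surjective f := by
    intro v
    obtain ⟨g, hg, hv⟩ := groups.exists_mem (Finset.mem_univ v)
    refine ⟨(γ.symm ⟨g, hg⟩, (ρ (γ (γ.symm ⟨g, hg⟩))).symm ⟨v, by simpa using hv⟩), ?_⟩
    simp [f]
  let e : V ≃ Fin U × Fin M := (Equiv.ofBijective f ⟨hinj, hsurj⟩).symm
  have he : ∀ (b : Finset V) v, v ∈ b.map e.toEmbedding ↔ f v ∈ b := by
    intro b v
    rw [Finset.mem_map_equiv]
    rfl
  refine ⟨blocks, inferInstance, fun b => b.1.map e.toEmbedding, ?_, ?_, ?_⟩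
  · intro b
    rw [Finset.card_map]
    exact hG.card_block b.1 b.2
  · intro b v w hv hw hvw
    by_contra hne
    rw [he] at hv hw
    rcases hG.pair (f v) (f w) (hinj.ne hne) with h | h
    · exact h.2 ⟨b.1, b.2, hv, hw⟩
    · exact h.1 ((hsame v w).2 hvw)
  · intro v w hvw
    simp only [he]
    rcases hG.pair (f v) (f w) (hinj.ne fun h => hvw (by rw [h])) with h | h
    · exact absurd ((hsame v w).1 h.1) hvw
    · obtain ⟨b, ⟨hb, hv, hw⟩, hu⟩ := h.2
      exact ⟨⟨b, hb⟩, ⟨hv, hw⟩, fun c hc => Subtype.ext (hu c.1 ⟨c.2, hc⟩)⟩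

/-- Replace each vertex of a block design by a group, and each block by a transversal design. -/
theorem inflate {K : ℕ} {Γ X P : Type} [Unique X] (h : GroupDivisibleExists K Γ X)
    (h' : GroupDivisibleExists K (Fin K) P) : GroupDivisibleExists K Γ P := by
  classical
  obtain ⟨B, hB, blk, h₁, h₂, h₃⟩ := h
  obtain ⟨C, hC, blc, g₁, g₂, g₃⟩ := h'
  let e : ∀ b, Fin K ≃ blk b := fun b => (Fintype.equivFinOfCardEq (by simpa using h₁ b)).symm
  have einj : ∀ b i j, (e b i).1.1 = (e b j).1.1 → i = j := fun b i j h =>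
    (e b).injective (Subtype.ext (Prod.ext h (Subsingleton.elim _ _)))
  have esurj : ∀ b γ, (γ, default) ∈ blk b → ∃ i, (e b i).1.1 = γ := fun b γ h =>
    ⟨(e b).symm ⟨_, h⟩, by simp⟩
  have emem : ∀ b i, ((e b i).1.1, default) ∈ blk b := fun b i => by
    rw [show ((e b i).1.1, default) = (e b i).1 from Prod.ext rfl (Subsingleton.elim _ _)]
    exact (e b i).2
  let f : ∀ b, Fin K × P ↪ Γ × P := fun b => ⟨fun v => ((e b v.1).1.1, v.2), fun v w h => by
    simp only [Prod.mk.injEq] at h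
    exact Prod.ext (einj b _ _ h.1) h.2⟩
  have hmem : ∀ b c (v : Γ × P), v ∈ (blc c).map (f b) ↔
      ∃ i, (e b i).1.1 = v.1 ∧ (i, v.2) ∈ blc c := by
    rintro b c ⟨γ, p⟩
    simp only [Finset.mem_map]
    constructor
    · rintro ⟨⟨i, q⟩, hi, hv⟩
      replace hv : ((e b i).1.1, q) = (γ, p) := hv
      simp only [Prod.mk.injEq] at hv
      exact ⟨i, hv.1, hv.2 ▸ hi⟩
    · rintro ⟨i, hi, hc⟩
      exact ⟨(i, p), hc, Prod.ext hi rfl⟩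
  refine ⟨B × C, inferInstance, fun b => (blc b.2).map (f b.1), fun b => by simp [g₁], ?_, ?_⟩
  · rintro ⟨b, c⟩ v w hv hw hvw
    rw [hmem] at hv hw
    obtain ⟨i, hi, hi'⟩ := hv
    obtain ⟨j, hj, hj'⟩ := hw
    obtain rfl := einj b i j (by rw [hi, hj, hvw])
    have := g₂ c _ _ hi' hj' rfl
    exact Prod.ext hvw (Prod.ext_iff.1 this).2
  · intro v w hvw
    obtain ⟨b, ⟨hv, hw⟩, hbu⟩ := h₃ (v.1, default) (w.1, default) hvw
    obtain ⟨i, hi⟩ := esurj _ _ hv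
    obtain ⟨j, hj⟩ := esurj _ _ hw
    have hij : i ≠ j := fun h => hvw (by rw [← hi, ← hj, h])
    obtain ⟨c, ⟨hc, hc'⟩, hcu⟩ := g₃ (i, v.2) (j, w.2) hij
    refine ⟨(b, c), ⟨(hmem _ _ _).2 ⟨i, hi, hc⟩, (hmem _ _ _).2 ⟨j, hj, hc'⟩⟩, ?_⟩
    rintro ⟨b', c'⟩ ⟨h, h'⟩
    obtain ⟨i', hi', k⟩ := (hmem _ _ _).1 h
    obtain ⟨j', hj', k'⟩ := (hmem _ _ _).1 h'
    obtain rfl := hbu b' ⟨hi' ▸ emem b' i', hj' ▸ emem b' j'⟩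
    obtain rfl := einj b' i i' (by rw [hi, hi'])
    obtain rfl := einj b' j j' (by rw [hj, hj'])
    rw [hcu c' ⟨k, k'⟩]

/-- Fill each group of a design with a copy of another design. -/
theorem fill {K : ℕ} {Γ Q P : Type} [Fintype Γ] (h : GroupDivisibleExists K Γ (Q × P))
    (h' : GroupDivisibleExists K Q P) : GroupDivisibleExists K (Γ × Q) P := by
  classical
  obtain ⟨B, hB, blk, h₁, h₂, h₃⟩ := h
  obtain ⟨C, hC, blc, g₁, g₂, g₃⟩ := h'
  let f : ∀ _ : Γ, Q × P ↪ (Γ × Q) × P := fun γ => ⟨fun v => ((γ, v.1), v.2), fun v w h => by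
    simpa [Prod.ext_iff] using h⟩
  have hmem : ∀ b (v : (Γ × Q) × P),
      v ∈ (blk b).map (Equiv.prodAssoc Γ Q P).symm.toEmbedding ↔ (v.1.1, (v.1.2, v.2)) ∈ blk b := by
    intro b v
    rw [Finset.mem_map_equiv]
    rfl
  have hmem' : ∀ γ c (v : (Γ × Q) × P), v ∈ (blc c).map (f γ) ↔
      v.1.1 = γ ∧ (v.1.2, v.2) ∈ blc c := by
    rintro γ c ⟨⟨γ', q⟩, p⟩
    simp only [Finset.mem_map]
    constructor
    · rintro ⟨⟨q', p'⟩, hi, hv⟩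
      replace hv : ((γ, q'), p') = ((γ', q), p) := hv
      simp only [Prod.mk.injEq] at hv
      obtain ⟨⟨rfl, rfl⟩, rfl⟩ := hv
      exact ⟨rfl, hi⟩
    · rintro ⟨rfl, hc⟩
      exact ⟨(q, p), hc, rfl⟩
  refine ⟨B ⊕ (Γ × C), inferInstance, fun b => match b with
    | .inl b => (blk b).map (Equiv.prodAssoc Γ Q P).symm.toEmbedding
    | .inr b => (blc b.2).map (f b.1), ?_, ?_, ?_⟩
  · rintro (b | ⟨γ, c⟩) <;> simp [h₁, g₁]
  · rintro (b | ⟨γ, c⟩) v w hv hw hvw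
    · rw [hmem] at hv hw
      have := h₂ b _ _ hv hw (by simp [hvw])
      simp only [Prod.mk.injEq] at this
      exact Prod.ext hvw this.2.2
    · rw [hmem'] at hv hw
      have := g₂ c _ _ hv.2 hw.2 (by simp [hvw])
      simp only [Prod.mk.injEq] at this
      exact Prod.ext hvw this.2
  · intro v w hvw
    by_cases hγ : v.1.1 = w.1.1
    · have hq : v.1.2 ≠ w.1.2 := fun h => hvw (Prod.ext hγ h)
      obtain ⟨c, ⟨hc, hc'⟩, hcu⟩ := g₃ (v.1.2, v.2) (w.1.2, w.2) hq
      refine ⟨.inr (v.1.1, c), ⟨(hmem' _ _ _).2 ⟨rfl, hc⟩, (hmem' _ _ _).2 ⟨hγ.symm, hc'⟩⟩, ?_⟩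
      rintro (b | ⟨γ, d⟩) ⟨k, k'⟩
      · have := h₂ b _ _ ((hmem _ _).1 k) ((hmem _ _).1 k') hγ
        simp only [Prod.mk.injEq] at this
        exact absurd this.2.1 hq
      · obtain ⟨rfl, k⟩ := (hmem' _ _ _).1 k
        rw [hcu d ⟨k, ((hmem' _ _ _).1 k').2⟩]
    · obtain ⟨b, ⟨hb, hb'⟩, hbu⟩ := h₃ (v.1.1, (v.1.2, v.2)) (w.1.1, (w.1.2, w.2)) hγ
      refine ⟨.inl b, ⟨(hmem _ _).2 hb, (hmem _ _).2 hb'⟩, ?_⟩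
      rintro (b' | ⟨γ, d⟩) ⟨k, k'⟩
      · rw [hbu b' ⟨(hmem _ _).1 k, (hmem _ _).1 k'⟩]
      · exact absurd (((hmem' _ _ _).1 k).1.trans ((hmem' _ _ _).1 k').1.symm) hγ

/-- Transversal designs with groups of size `M * K ^ j` combine to a design of type
`M ^ (K ^ J)`. -/
theorem of_pow {K M : ℕ} : ∀ {J : ℕ},
    (∀ j < J, GroupDivisibleExists K (Fin K) (Fin (M * K ^ j))) →
      GroupDivisibleExists K (Fin (K ^ J)) (Fin M)
  | 0, _ => by
    have : Subsingleton (Fin (K ^ 0)) := by rw [pow_zero]; infer_instance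
    exact of_subsingleton _ _ _
  | J + 1, h => by
    have e : Fin (M * K ^ J) ≃ Fin (K ^ J) × Fin M :=
      (finCongr (mul_comm _ _)).trans finProdFinEquiv.symm
    have e' : Fin K × Fin (K ^ J) ≃ Fin (K ^ (J + 1)) :=
      finProdFinEquiv.trans (finCongr (pow_succ' K J).symm)
    exact (((h J J.lt_succ_self).congr (Equiv.refl _) e).fill
      (of_pow fun j hj => h j (by omega))).congr e' (Equiv.refl _)

end GroupDivisibleExists

open scoped Matrix in
/-- All vectors of the family have squared norm `S`, and the inner products of distinct vectors
are unimodular. -/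
def IsUnimodularSystem {ι κ : Type} [Fintype κ] (S : ℝ) (ψ : ι → κ → ℂ) : Prop :=
  (∀ n, star (ψ n) ⬝ᵥ ψ n = S) ∧ ∀ n n', n ≠ n' → ‖star (ψ n) ⬝ᵥ ψ n'‖ = 1

open scoped Matrix ComplexOrder in
/-- Equality in the Welch bound implies tightness. -/
theorem IsUnimodularSystem.frameOperator_eq {ι κ : Type} [Fintype ι] [Fintype κ] [DecidableEq κ]
    {S : ℝ} {ψ : ι → κ → ℂ} (h : IsUnimodularSystem S ψ) (hκ : 0 < Fintype.card κ)
    (hcard : (Fintype.card ι : ℝ) * S ^ 2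
      = Fintype.card κ * (S ^ 2 + Fintype.card ι - 1)) :
    (Matrix.of ψ)ᵀ * (Matrix.of ψ)ᵀᴴ
      = ((Fintype.card ι * S / Fintype.card κ : ℝ) : ℂ) • (1 : Matrix κ κ ℂ) := by
  classical
  set Φ : Matrix κ ι ℂ := (Matrix.of ψ)ᵀ
  set a : ℝ := Fintype.card ι * S / Fintype.card κ with ha
  have hG : ∀ n n', (Φᴴ * Φ) n n' = star (ψ n) ⬝ᵥ ψ n' := fun n n' => rfl
  have htr : (Φ * Φᴴ).trace = Fintype.card ι * S := by
    rw [Matrix.trace_mul_comm, Matrix.trace]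
    simp [hG, h.1]
  have htr2 : (Φ * Φᴴ * (Φ * Φᴴ)).trace = Fintype.card ι * (S ^ 2 + Fintype.card ι - 1) := by
    have hcyc : (Φ * Φᴴ * (Φ * Φᴴ)).trace = ((Φᴴ * Φ) * (Φᴴ * Φ)ᴴ).trace := by
      rw [Matrix.mul_assoc, Matrix.trace_mul_comm]
      simp [Matrix.conjTranspose_mul, Matrix.mul_assoc]
    have hrow : ∀ n, ((Φᴴ * Φ) * (Φᴴ * Φ)ᴴ) n n = S ^ 2 + Fintype.card ι - 1 := by
      intro n
      have hterm : ∀ n', (Φᴴ * Φ) n n' * star ((Φᴴ * Φ) n n')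
          = if n = n' then (S : ℂ) ^ 2 else 1 := by
        intro n'
        rw [Complex.star_def, Complex.mul_conj', hG]
        split_ifs with hn
        · subst hn
          rw [h.1, Complex.norm_real, ← Complex.ofReal_pow, Real.norm_eq_abs, sq_abs,
            Complex.ofReal_pow]
        · rw [h.2 n n' hn]; simp
      have hterm' : ∀ n', (Φᴴ * Φ) n n' * star ((Φᴴ * Φ) n n')
          = (if n = n' then (S : ℂ) ^ 2 - 1 else 0) + 1 := by
        intro n'
        rw [hterm]
        split_ifs <;> ring
      rw [Matrix.mul_apply]
      simp only [Matrix.conjTranspose_apply] at hterm' ⊢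
      rw [Finset.sum_congr rfl fun n' _ => hterm' n', Finset.sum_add_distrib,
        Finset.sum_ite_eq]
      simp
      ring
    rw [hcyc, Matrix.trace]
    simp only [Matrix.diag_apply, hrow]
    simp
    ring
  have hD : (Fintype.card κ : ℝ) ≠ 0 := by exact_mod_cast hκ.ne'
  have hE : (Φ * Φᴴ - (a : ℂ) • (1 : Matrix κ κ ℂ)) = 0 := by
    rw [← Matrix.trace_mul_conjTranspose_self_eq_zero_iff]
    have hself : (Φ * Φᴴ - (a : ℂ) • (1 : Matrix κ κ ℂ))ᴴ = Φ * Φᴴ - (a : ℂ) • 1 := by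
      simp [Matrix.conjTranspose_sub, Matrix.conjTranspose_mul, Matrix.conjTranspose_smul]
    have hreal : (Fintype.card ι : ℝ) * (S ^ 2 + Fintype.card ι - 1) - 2 * a * (Fintype.card ι * S)
        + a ^ 2 * Fintype.card κ = 0 := by
      rw [ha]
      field_simp
      linear_combination (-(Fintype.card ι : ℝ)) * hcard
    rw [hself, sub_mul, mul_sub, mul_sub]
    simp only [Matrix.smul_mul, Matrix.mul_smul, one_mul, mul_one, Matrix.trace_sub,
      Matrix.trace_smul, Matrix.trace_one, htr, htr2, smul_eq_mul]
    have := congrArg (fun r : ℝ => (r : ℂ)) hreal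
    push_cast at this
    linear_combination this
  exact sub_eq_zero.1 hE

open scoped Matrix in
theorem IsUnimodularSystem.reindex {ι κ ι' κ' : Type} [Fintype κ] [Fintype κ'] {S : ℝ}
    {ψ : ι → κ → ℂ} (h : IsUnimodularSystem S ψ) (e : ι' ≃ ι) (f : κ' ≃ κ) :
    IsUnimodularSystem S fun n k => ψ (e n) (f k) := by
  have key : ∀ n n', (star fun k => ψ (e n) (f k)) ⬝ᵥ (fun k => ψ (e n') (f k))
      = star (ψ (e n)) ⬝ᵥ ψ (e n') := fun n n' =>
    Equiv.sum_comp f fun k => star (ψ (e n) k) * ψ (e n') k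
  exact ⟨fun n => by rw [key, h.1], fun n n' hn => by rw [key, h.2 _ _ (e.injective.ne hn)]⟩

open scoped Matrix in
theorem IsUnimodularSystem.isETF {N D : ℕ} {S : ℝ} {ψ : Fin N → Fin D → ℂ}
    (h : IsUnimodularSystem S ψ) (hS : 0 < S) (hD : 0 < D) (hN : 0 < N)
    (hcard : (N : ℝ) * S ^ 2 = D * (S ^ 2 + N - 1)) :
    IsETF fun n => (WithLp.toLp 2 (ψ n) : EuclideanSpace ℂ (Fin D)) := by
  have hF := h.frameOperator_eq (by simpa using hD) (by simpa using hcard)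
  simp only [Fintype.card_fin] at hF
  have hinner : ∀ n n', inner ℂ (WithLp.toLp 2 (ψ n) : EuclideanSpace ℂ (Fin D))
      (WithLp.toLp 2 (ψ n')) = star (ψ n) ⬝ᵥ ψ n' := fun n n' => by
    rw [EuclideanSpace.inner_eq_star_dotProduct, dotProduct_comm]
  refine ⟨⟨N * S / D, by positivity, fun x => ?_⟩, ⟨S, hS, fun n => ?_⟩, ⟨1, fun n n' hn => ?_⟩⟩
  · have h₁ : ∀ n, inner ℂ (WithLp.toLp 2 (ψ n) : EuclideanSpace ℂ (Fin D)) x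
        = ((Matrix.of ψ)ᵀᴴ *ᵥ x.ofLp) n := fun n => by
      rw [EuclideanSpace.inner_eq_star_dotProduct, dotProduct_comm]
      rfl
    have h₂ : ((∑ n, ‖inner ℂ (WithLp.toLp 2 (ψ n) : EuclideanSpace ℂ (Fin D)) x‖ ^ 2 : ℝ) : ℂ)
        = star ((Matrix.of ψ)ᵀᴴ *ᵥ x.ofLp) ⬝ᵥ ((Matrix.of ψ)ᵀᴴ *ᵥ x.ofLp) := by
      simp only [h₁, dotProduct, Complex.ofReal_sum, Complex.ofReal_pow, Pi.star_apply]
      exact Finset.sum_congr rfl fun n _ => by rw [Complex.star_def, Complex.conj_mul']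
    have h₃ : ((‖x‖ ^ 2 : ℝ) : ℂ) = star x.ofLp ⬝ᵥ x.ofLp := by
      have := inner_self_eq_norm_sq_to_K (𝕜 := ℂ) x
      rw [EuclideanSpace.inner_eq_star_dotProduct, dotProduct_comm] at this
      rw [this]
      simp
    rw [← Complex.ofReal_inj, h₂, Complex.ofReal_mul, h₃, Matrix.star_mulVec,
      Matrix.conjTranspose_conjTranspose, ← Matrix.dotProduct_mulVec, Matrix.mulVec_mulVec, hF,
      Matrix.smul_mulVec, Matrix.one_mulVec, dotProduct_smul, smul_eq_mul]
  · have := inner_self_eq_norm_sq_to_K (𝕜 := ℂ) (WithLp.toLp 2 (ψ n) : EuclideanSpace ℂ (Fin D))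
    rw [hinner, h.1] at this
    rw [← Complex.ofReal_inj, this]
    simp
  · rw [hinner, h.2 n n' hn]

/-- A unimodular system of the size prescribed by a type is an equiangular tight frame. -/
theorem IsUnimodularSystem.etfOfTypeExists {ι κ : Type} [Fintype ι] [Fintype κ] {K T M : ℕ}
    {ψ : ι → κ → ℂ} (h : IsUnimodularSystem (T + 1) ψ) (hK : 2 ≤ K)
    (hM : M + 1 + (T + 1) = (T + 1) * K) (hκ : K * Fintype.card κ = (T + 1) * M)
    (hι : Fintype.card ι = T * M) (hD : 1 < Fintype.card κ) :
    ETFOfTypeExists K (-1) (T + 1) := by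
  set D := Fintype.card κ with hDdef
  have hMZ : (M : ℤ) = (T + 1) * (K - 1) + -1 := by
    have := congrArg (fun n : ℕ => (n : ℤ)) hM
    push_cast at this
    linarith
  have hlt : D < T * M := by
    by_contra hle
    push Not at hle
    have h₁ : K * (T * M) ≤ (T + 1) * M := hκ ▸ Nat.mul_le_mul_left K hle
    have hM0 : 0 < M := by
      rcases Nat.eq_zero_or_pos M with rfl | h0
      · simp at hκ; omega
      · exact h0
    have h₂ : K * T ≤ T + 1 := Nat.le_of_mul_le_mul_right (by linarith) hM0
    rcases Nat.eq_zero_or_pos T with rfl | hT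
    · simp only [zero_add, one_mul] at hM hκ
      have : K * 2 ≤ K * D := Nat.mul_le_mul_left K hD
      omega
    · have h2T : 2 * T ≤ K * T := Nat.mul_le_mul_right T hK
      have hT1 : T = 1 := by omega
      subst hT1
      have hK2 : K = 2 := by omega
      subst hK2
      omega
  refine ⟨D, T * M, ⟨hD, hlt, Or.inr rfl, by positivity, ?_, ?_⟩, ?_⟩
  · have hKQ : ((K : ℤ) : ℚ) ≠ 0 := by positivity
    have h₁ : ((K : ℚ)) * D = (T + 1) * M := by exact_mod_cast hκ
    have h₂ : (M : ℚ) = (T + 1) * (K - 1) + -1 := by exact_mod_cast hMZ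
    rw [h₂] at h₁
    field_simp
    push_cast
    linarith
  · push_cast
    rw [hMZ]
    ring
  · let e : Fin (T * M) ≃ ι := (Fintype.equivFinOfCardEq hι).symm
    let f : Fin D ≃ κ := (Fintype.equivFinOfCardEq rfl).symm
    refine ⟨_, (h.reindex e f).isETF (by positivity) (by omega) (by omega) ?_⟩
    have hKR : (K : ℝ) ≠ 0 := by positivity
    have h₁ : ((K : ℝ)) * D = (T + 1) * M := by exact_mod_cast hκ
    have h₂ : (M : ℝ) = (T + 1) * (K - 1) + -1 := by exact_mod_cast hMZ
    apply mul_left_cancel₀ hKR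
    push_cast
    rw [← mul_assoc (K : ℝ) (D : ℝ), h₁, h₂]
    ring

/-- Tightness determines the coherence of an equiangular tight frame. -/
theorem IsETF.exists_constants {D N : ℕ} {φ : Fin N → EuclideanSpace ℂ (Fin D)} (h : IsETF φ)
    (hN : 2 ≤ N) : ∃ C c : ℝ, 0 < C ∧ 0 ≤ c ∧ (∀ n, ‖φ n‖ ^ 2 = C) ∧
      (∀ n n', n ≠ n' → ‖inner ℂ (φ n) (φ n')‖ = c) ∧
        N * C ^ 2 = D * (C ^ 2 + (N - 1) * c ^ 2) := by
  obtain ⟨⟨A, hA, htight⟩, ⟨C, hC, hnorm⟩, ⟨c, hc⟩⟩ := h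
  let n₀ : Fin N := ⟨0, by omega⟩
  let n₁ : Fin N := ⟨1, by omega⟩
  have hc0 : 0 ≤ c := by
    rw [← hc n₀ n₁ (by simp [n₀, n₁])]
    positivity
  refine ⟨C, c, hC, hc0, hnorm, hc, ?_⟩
  have h₁ : A * C = C ^ 2 + (N - 1) * c ^ 2 := by
    have := htight (φ n₀)
    rw [hnorm, ← Finset.add_sum_erase _ _ (Finset.mem_univ n₀), inner_self_eq_norm_sq_to_K,
      Finset.sum_congr rfl fun n hn => by rw [hc n n₀ (Finset.ne_of_mem_erase hn)]] at this
    rw [this]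
    simp [← hnorm n₀, Nat.cast_sub (show 1 ≤ N by omega)]
  have h₂ : A * D = N * C := by
    have hsum : ∑ i : Fin D, A * ‖EuclideanSpace.single i (1 : ℂ)‖ ^ 2
        = ∑ n, ‖φ n‖ ^ 2 := by
      rw [Finset.sum_congr rfl fun i _ => htight (EuclideanSpace.single i (1 : ℂ)),
        Finset.sum_comm]
      refine Finset.sum_congr rfl fun n _ => ?_
      rw [EuclideanSpace.norm_sq_eq]
      refine Finset.sum_congr rfl fun i _ => ?_
      rw [EuclideanSpace.inner_single_right]
      simp
    simp only [hnorm] at hsum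
    simp at hsum
    linarith
  linear_combination D * h₁ - C * h₂

open scoped Matrix in
theorem ETFOfTypeExists.exists_isUnimodularSystem {K : ℕ} {S : ℤ}
    (h : ETFOfTypeExists K (-1) S) :
    2 ≤ K ∧ ∃ T M D : ℕ, S = T + 1 ∧ 0 < T ∧ M + 1 + (T + 1) = (T + 1) * K ∧
      K * D = (T + 1) * M ∧ 1 < D ∧ ∃ ψ : Fin M × Fin T → Fin D → ℂ,
        IsUnimodularSystem (T + 1) ψ := by
  obtain ⟨D, N, ⟨hD, hDN, -, hS, hDK, hN⟩, φ, hφ⟩ := h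
  obtain ⟨T, rfl⟩ : ∃ T : ℕ, S = T + 1 := ⟨(S - 1).toNat, by omega⟩
  have hK0 : (K : ℤ) ≠ 0 := by
    intro h0
    rw [h0] at hDK
    simp at hDK
    omega
  have hDK' : (K : ℤ) * D = (T + 1) * ((T + 1) * (K - 1) + -1) := by
    have hKQ : (K : ℚ) ≠ 0 := by exact_mod_cast hK0
    have : (K : ℚ) * D = (T + 1) * ((T + 1) * (K - 1) + -1) := by
      rw [hDK]
      push_cast
      field_simp
    exact_mod_cast this
  have hMpos : 0 < ((T : ℤ) + 1) * (K - 1) + -1 := by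
    have : 0 < (K : ℤ) * D := by positivity
    rw [hDK'] at this
    exact pos_of_mul_pos_right this (by positivity)
  have hK2 : 2 ≤ K := by
    by_contra hlt
    have : K = 1 := by omega
    subst this
    simp at hMpos
  obtain ⟨M, hM⟩ := Int.eq_ofNat_of_zero_le hMpos.le
  rw [hM] at hDK' hN
  have hT : 0 < T := by
    rcases Nat.eq_zero_or_pos T with rfl | h0
    · simp at hN; omega
    · exact h0
  have hNM : N = M * T := by
    have : (N : ℤ) = M * T := by rw [hN]; ring
    exact_mod_cast this
  have hKD : K * D = (T + 1) * M := by exact_mod_cast hDK'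
  refine ⟨hK2, T, M, D, rfl, hT, ?_, hKD, hD, ?_⟩
  · zify
    linear_combination -hM
  obtain ⟨C, c, hC, hc0, hnorm, hc, hwelch⟩ := hφ.exists_constants (by omega)
  have hcC : (T + 1) * c = C := by
    have hKR : (K : ℝ) ≠ 0 := by positivity
    have h₁ : (K : ℝ) * D = (T + 1) * M := by exact_mod_cast hKD
    have h₂ : ((T : ℝ) + 1) * (K - 1) + -1 = M := by exact_mod_cast hM
    have h₃ : (N : ℝ) = M * T := by exact_mod_cast hNM
    have h₄ : (1 : ℝ) < N - D + 1 := by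
      have : (D : ℝ) < N := by exact_mod_cast hDN
      linarith
    have h₅ : (K : ℝ) * (N - D) * (C ^ 2 - ((T + 1) * c) ^ 2) = 0 := by
      have e₁ : (K : ℝ) * D * (N - 1) = K * (N - D) * (T + 1) ^ 2 := by
        rw [mul_sub (K : ℝ), h₁, h₃, ← h₂]
        ring
      linear_combination K * hwelch + c ^ 2 * e₁
    have h₆ : C ^ 2 = ((T + 1) * c) ^ 2 := by
      rcases mul_eq_zero.1 h₅ with h | h
      · rcases mul_eq_zero.1 h with h | h
        · exact absurd h hKR
        · linarith
      · linarith
    exact ((sq_eq_sq₀ hC.le (by positivity)).1 h₆).symm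
  have hcpos : 0 < c := by
    by_contra hle
    have : c = 0 := le_antisymm (not_lt.1 hle) hc0
    rw [this] at hcC
    linarith
  let e : Fin M × Fin T ≃ Fin N := finProdFinEquiv.trans (finCongr hNM.symm)
  have hkey : ∀ n n', star (fun k => (Real.sqrt c : ℂ)⁻¹ * φ (e n) k) ⬝ᵥ
      (fun k => (Real.sqrt c : ℂ)⁻¹ * φ (e n') k)
      = (c : ℂ)⁻¹ * inner ℂ (φ (e n)) (φ (e n')) := by
    intro n n'
    have hs : (Real.sqrt c : ℂ)⁻¹ * (Real.sqrt c : ℂ)⁻¹ = (c : ℂ)⁻¹ := by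
      rw [← mul_inv, ← Complex.ofReal_mul, Real.mul_self_sqrt hc0]
    rw [EuclideanSpace.inner_eq_star_dotProduct, dotProduct, dotProduct, Finset.mul_sum]
    refine Finset.sum_congr rfl fun k _ => ?_
    rw [← hs]
    simp
    ring
  refine ⟨fun n k => (Real.sqrt c : ℂ)⁻¹ * φ (e n) k, fun n => ?_, fun n n' hn => ?_⟩
  · rw [hkey, inner_self_eq_norm_sq_to_K]
    have := hnorm (e n)
    rw [← hcC] at this
    have hc' : (c : ℂ) ≠ 0 := by exact_mod_cast hcpos.ne'
    have h' := congrArg (fun r : ℝ => (r : ℂ)) this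
    push_cast at h' ⊢
    rw [inv_mul_eq_iff_eq_mul₀ hc']
    simpa [mul_comm] using h'
  · rw [hkey, norm_mul, hc _ _ (e.injective.ne hn), norm_inv, Complex.norm_real, Real.norm_eq_abs,
      abs_of_pos hcpos, inv_mul_cancel₀ hcpos.ne']

open scoped Matrix

/-- The character table of a cyclic group of order `n`. -/
theorem exists_fourier (n : ℕ) : ∃ h : Fin n → Fin n → ℂ, (∀ a b, ‖h a b‖ = 1) ∧
    ∀ a a', ∑ b, star (h a b) * h a' b = if a = a' then (n : ℂ) else 0 := by
  rcases Nat.eq_zero_or_pos n with rfl | hn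
  · exact ⟨fun a => a.elim0, fun a => a.elim0, fun a => a.elim0⟩
  have hω := Complex.isPrimitiveRoot_exp n hn.ne'
  set ω := Complex.exp (2 * Real.pi * Complex.I / n)
  have hnorm : ‖ω‖ = 1 := hω.norm'_eq_one hn.ne'
  have hω0 : ω ≠ 0 := hω.ne_zero hn.ne'
  refine ⟨fun a b => ω ^ (a.val * b.val), fun a b => by simp [hnorm], fun a a' => ?_⟩
  have hstar : star ω = ω⁻¹ := by
    rw [Complex.inv_def, Complex.normSq_eq_norm_sq, hnorm]
    simp
  have hterm : ∀ b : Fin n, star (ω ^ (a.val * b.val)) * ω ^ (a'.val * b.val)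
      = (ω ^ a'.val * (ω ^ a.val)⁻¹) ^ b.val := by
    intro b
    rw [star_pow, hstar, mul_pow, pow_mul, pow_mul, inv_pow, mul_comm]
  rw [Finset.sum_congr rfl fun b _ => hterm b]
  split_ifs with h
  · subst h
    simp [hω0]
  · rw [Fin.sum_univ_eq_sum_range fun b => (ω ^ a'.val * (ω ^ a.val)⁻¹) ^ b]
    have hne : ω ^ a'.val * (ω ^ a.val)⁻¹ ≠ 1 := by
      intro h1
      rw [mul_inv_eq_one₀ (pow_ne_zero _ hω0)] at h1
      exact h (Fin.ext (hω.pow_inj a'.2 a.2 h1)).symm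
    rw [geom_sum_eq hne, mul_pow, ← pow_mul, inv_pow, ← pow_mul, mul_comm a'.val,
      mul_comm a.val, pow_mul, pow_mul, hω.pow_eq_one]
    simp

/-- Removing one column from the character table. -/
theorem exists_truncated_fourier (n : ℕ) : ∃ h : Fin (n + 1) → Fin n → ℂ, (∀ a b, ‖h a b‖ = 1) ∧
    ∀ a a', ∑ b, star (h a b) * h a' b = if a = a' then (n : ℂ) else -1 := by
  obtain ⟨h, h₁, h₂⟩ := exists_fourier (n + 1)
  have hunit : ∀ a b, star (h a b) * h a b = 1 := fun a b => by
    rw [Complex.star_def, Complex.conj_mul', h₁]; simp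
  refine ⟨fun a b => h a b.succ * star (h a 0), fun a b => by simp [h₁], fun a a' => ?_⟩
  have key : ∀ b, star (h a b * star (h a 0)) * (h a' b * star (h a' 0))
      = (h a 0 * star (h a' 0)) * (star (h a b) * h a' b) := fun b => by
    simp only [star_mul', star_star]; ring
  have := h₂ a a'
  rw [Fin.sum_univ_succ] at this
  rw [Finset.sum_congr rfl fun b _ => key b.succ, ← Finset.mul_sum, eq_sub_of_add_eq' this]
  split_ifs with hab
  · subst hab
    rw [hunit, mul_comm, mul_comm (h a 0), hunit]
    push_cast
    ring
  · linear_combination (-(h a' 0 * star (h a' 0))) * hunit a 0 - hunit a' 0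

/-- A rectangular piece of the character table of a product of cyclic groups. -/
theorem exists_block_fourier (Q T : ℕ) : ∃ f : Fin (Q + 1) × Fin T → Fin Q × Fin T → ℂ,
    (∀ x y, ‖f x y‖ = 1) ∧ ∀ x x', ∑ y, star (f x y) * f x' y =
      if x = x' then ((Q * T : ℕ) : ℂ) else if x.2 = x'.2 then -(T : ℂ) else 0 := by
  obtain ⟨g, g₁, g₂⟩ := exists_truncated_fourier Q
  obtain ⟨h, h₁, h₂⟩ := exists_fourier T
  refine ⟨fun x y => g x.1 y.1 * h x.2 y.2, fun x y => by simp [g₁, h₁], fun x x' => ?_⟩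
  have : ∑ y : Fin Q × Fin T, star (g x.1 y.1 * h x.2 y.2) * (g x'.1 y.1 * h x'.2 y.2)
      = (∑ b, star (g x.1 b) * g x'.1 b) * ∑ b, star (h x.2 b) * h x'.2 b := by
    rw [Finset.sum_mul_sum, Fintype.sum_prod_type]
    refine Finset.sum_congr rfl fun a _ => Finset.sum_congr rfl fun b _ => ?_
    simp only [star_mul']; ring
  rw [this, g₂, h₂]
  by_cases e₁ : x.1 = x'.1 <;> by_cases e₂ : x.2 = x'.2 <;> simp [Prod.ext_iff, e₁, e₂]

/-- Combine the vectors of a unimodular system, placed on the groups of a design, with Fourier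
entries on the blocks. -/
theorem IsUnimodularSystem.combine {T Q : ℕ} {Γ P κ B : Type} [Fintype Γ] [DecidableEq Γ]
    [DecidableEq P] [Fintype κ] [Fintype B] {ψ : P × Fin T → κ → ℂ}
    (hψ : IsUnimodularSystem (T + 1) ψ) (blk : B → Finset (Γ × P))
    (hgroup : ∀ b v w, v ∈ blk b → w ∈ blk b → v.1 = w.1 → v = w)
    (hpair : ∀ v w, v.1 ≠ w.1 → ∃! b, v ∈ blk b ∧ w ∈ blk b)
    (hdeg : ∀ v, Fintype.card {b // v ∈ blk b} = Q * T) :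
    ∃ φ : (Γ × P) × (Fin (Q + 1) × Fin T) → (Γ × κ) ⊕ B → ℂ,
      IsUnimodularSystem (((Q + 1) * T : ℕ) + 1) φ := by
  classical
  obtain ⟨f, f₁, f₂⟩ := exists_block_fourier Q T
  let e : ∀ v, {b // v ∈ blk b} ≃ Fin Q × Fin T := fun v =>
    Fintype.equivOfCardEq (by simp [hdeg])
  let α : (Γ × P) × (Fin (Q + 1) × Fin T) → Γ × κ → ℂ := fun n k =>
    if k.1 = n.1.1 then ψ (n.1.2, n.2.2) k.2 else 0
  let β : (Γ × P) × (Fin (Q + 1) × Fin T) → B → ℂ := fun n b =>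
    if h : n.1 ∈ blk b then f n.2 (e n.1 ⟨b, h⟩) else 0
  have hsum : ∀ n n', star (Sum.elim (α n) (β n)) ⬝ᵥ Sum.elim (α n') (β n')
      = star (α n) ⬝ᵥ α n' + star (β n) ⬝ᵥ β n' := fun n n' => by
    simp only [dotProduct, Fintype.sum_sum_type]
    rfl
  have hα : ∀ n n', star (α n) ⬝ᵥ α n' = if n.1.1 = n'.1.1
      then star (ψ (n.1.2, n.2.2)) ⬝ᵥ ψ (n'.1.2, n'.2.2) else 0 := by
    intro n n'
    have hterm : ∀ γ : Γ, ∑ k, star (α n) (γ, k) * α n' (γ, k) = if γ = n.1.1 then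
        (if n.1.1 = n'.1.1 then star (ψ (n.1.2, n.2.2)) ⬝ᵥ ψ (n'.1.2, n'.2.2) else 0) else 0 := by
      intro γ
      by_cases h₁ : γ = n.1.1
      · subst h₁
        by_cases h₂ : n.1.1 = n'.1.1
        · simp [α, h₂, dotProduct]
        · simp [α, h₂]
      · simp [α, h₁]
    rw [dotProduct, Fintype.sum_prod_type, Finset.sum_congr rfl fun γ _ => hterm γ]
    simp
  have hβ₁ : ∀ v x x', star (β (v, x)) ⬝ᵥ β (v, x') = ∑ y, star (f x y) * f x' y := by
    intro v x x'
    have hterm : ∀ b, star (β (v, x)) b * β (v, x') b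
        = if h : v ∈ blk b then star (f x (e v ⟨b, h⟩)) * f x' (e v ⟨b, h⟩) else 0 := by
      intro b
      by_cases h : v ∈ blk b <;> simp [β, h]
    rw [dotProduct, Finset.sum_congr rfl fun b _ => hterm b,
      ← Equiv.sum_comp (e v) fun y => star (f x y) * f x' y]
    rw [← Finset.sum_filter_of_ne (p := fun b => v ∈ blk b),
      Finset.sum_subtype (p := fun b => v ∈ blk b) _ (by simp)]
    · exact Finset.sum_congr rfl fun b _ => dif_pos b.2
    · intro b _ hne
      by_contra h
      exact hne (dif_neg h)
  have hβ₂ : ∀ n n', n.1 ≠ n'.1 → n.1.1 = n'.1.1 → star (β n) ⬝ᵥ β n' = 0 := by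
    intro n n' hne heq
    refine Finset.sum_eq_zero fun b _ => ?_
    by_cases h₁ : n.1 ∈ blk b
    · have h₂ : n'.1 ∉ blk b := fun h₂ => hne (hgroup b _ _ h₁ h₂ heq)
      simp [β, h₂]
    · simp [β, h₁]
  have hβ₃ : ∀ n n', n.1.1 ≠ n'.1.1 → ‖star (β n) ⬝ᵥ β n'‖ = 1 := by
    intro n n' hne
    obtain ⟨b, ⟨hb, hb'⟩, hu⟩ := hpair _ _ hne
    rw [dotProduct, Finset.sum_eq_single b]
    · simp [β, hb, hb', f₁]
    · intro c _ hcb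
      by_cases h₁ : n.1 ∈ blk c
      · have h₂ : n'.1 ∉ blk c := fun h₂ => hcb (hu c ⟨h₁, h₂⟩)
        simp [β, h₂]
      · simp [β, h₁]
    · simp
  refine ⟨fun n => Sum.elim (α n) (β n), ?_, ?_⟩
  · rintro ⟨v, x⟩
    rw [hsum, hα, hβ₁, f₂, if_pos rfl, if_pos rfl, hψ.1]
    push_cast
    ring
  · rintro ⟨v, x⟩ ⟨v', x'⟩ hne
    rw [hsum, hα]
    by_cases hv : v = v'
    · subst hv
      have hx : x ≠ x' := fun h => hne (by rw [h])
      rw [hβ₁, f₂, if_neg hx, if_pos rfl]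
      by_cases h2 : x.2 = x'.2
      · rw [if_pos h2, h2, hψ.1]
        simp
      · rw [if_neg h2, add_zero, hψ.2 _ _ (by simpa using h2)]
    · by_cases hγ : v.1 = v'.1
      · rw [hβ₂ _ _ hv hγ, if_pos hγ, add_zero, hψ.2]
        exact fun h => hv (Prod.ext hγ (congrArg Prod.fst h))
      · rw [if_neg hγ, zero_add, hβ₃ _ _ hγ]

theorem GroupDivisibleExists.etfOfTypeExists {K U M : ℕ} {S : ℤ}
    (hG : GroupDivisibleExists K (Fin U) (Fin M)) (hU : 0 < U) (hE : ETFOfTypeExists K (-1) S)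
    (hdvd : (S - 1) ∣ ((K : ℤ) - 2)) (hM : (M : ℤ) = S * ((K : ℤ) - 1) - 1) :
    ∃ S' : ℤ, S' * (K - 1) = M * U + 1 ∧ ETFOfTypeExists K (-1) S' := by
  classical
  obtain ⟨hK, T, M', D, rfl, hT, hM', hD, hD1, ψ, hψ⟩ := hE.exists_isUnimodularSystem
  obtain rfl : M = M' := by
    zify at hM' ⊢
    linear_combination hM - hM'
  obtain ⟨B, _, blk, h₁, h₂, h₃⟩ := hG
  have hM0 : 0 < M := by
    rcases Nat.eq_zero_or_pos M with rfl | h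
    · simp at hD; omega
    · exact h
  have hcount : ∀ v, Fintype.card {b // v ∈ blk b} * (K - 1) = M * (U - 1) := by
    intro v
    have e₁ : ∀ b : {b // v ∈ blk b}, ((blk b.1).erase v).card = K - 1 := fun b => by
      rw [Finset.card_erase_of_mem b.2, h₁]
    have e₂ : (Finset.univ.filter fun w : Fin U × Fin M => v.1 ≠ w.1)
        = Finset.univ.biUnion fun b : {b // v ∈ blk b} => (blk b.1).erase v := by
      ext w
      simp only [Finset.mem_filter, Finset.mem_univ, true_and, Finset.mem_biUnion,
        Finset.mem_erase]
      constructor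
      · intro h
        obtain ⟨b, ⟨hb, hb'⟩, -⟩ := h₃ v w h
        exact ⟨⟨b, hb⟩, fun h' => h (by rw [h']), hb'⟩
      · rintro ⟨b, hne, hw⟩ h
        exact hne (h₂ b.1 v w b.2 hw h).symm
    have e₃ : (Finset.univ.filter fun w : Fin U × Fin M => v.1 ≠ w.1).card = (U - 1) * M := by
      have : (Finset.univ.filter fun w : Fin U × Fin M => v.1 ≠ w.1)
          = (Finset.univ.erase v.1) ×ˢ Finset.univ := by
        ext w
        simp [eq_comm]
      rw [this, Finset.card_product, Finset.card_erase_of_mem (Finset.mem_univ _)]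
      simp
    rw [e₂, Finset.card_biUnion, Finset.sum_congr rfl fun b _ => e₁ b] at e₃
    · simpa [mul_comm M] using e₃
    · intro b _ c _ hbc
      rw [Function.onFun, Finset.disjoint_left]
      intro w hw hw'
      rw [Finset.mem_erase] at hw hw'
      have hne : v.1 ≠ w.1 := fun h => hw.1 (h₂ b.1 v w b.2 hw.2 h).symm
      exact hbc (Subtype.ext ((h₃ v w hne).unique ⟨b.2, hw.2⟩ ⟨c.2, hw'.2⟩))
  have hTK : (T : ℤ) ∣ (K : ℤ) - 2 := by simpa using hdvd
  have hTM : (T : ℤ) ∣ M := by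
    rw [hM]
    have : ((T : ℤ) + 1) * (K - 1) - 1 = T * (K - 1) + (K - 2) := by ring
    rw [this]
    exact dvd_add (dvd_mul_right _ _) hTK
  have hTR : ∀ v, T ∣ Fintype.card {b // v ∈ blk b} := by
    intro v
    have h := congrArg (fun n : ℕ => (n : ℤ)) (hcount v)
    rw [← Int.natCast_dvd_natCast]
    push_cast [Nat.cast_sub (show 1 ≤ K by omega), Nat.cast_sub (show 1 ≤ U by omega)] at h
    have : (Fintype.card {b // v ∈ blk b} : ℤ)
        = M * (U - 1) - Fintype.card {b // v ∈ blk b} * (K - 2) := by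
      linear_combination h
    rw [this]
    exact dvd_sub (hTM.mul_right _) (hTK.mul_left _)
  let v₀ : Fin U × Fin M := (⟨0, hU⟩, ⟨0, hM0⟩)
  obtain ⟨Q, hQ⟩ := hTR v₀
  have hdeg : ∀ v, Fintype.card {b // v ∈ blk b} = Q * T := by
    intro v
    rw [mul_comm, ← hQ]
    exact Nat.eq_of_mul_eq_mul_right (show 0 < K - 1 by omega) ((hcount v).trans (hcount v₀).symm)
  have hQU : (Q * T : ℤ) * (K - 1) = M * (U - 1) := by
    have h := congrArg (fun n : ℕ => (n : ℤ)) (hcount v₀)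
    rw [hdeg] at h
    push_cast [Nat.cast_sub (show 1 ≤ K by omega), Nat.cast_sub (show 1 ≤ U by omega)] at h
    exact h
  have hB : K * Fintype.card B = U * M * (Q * T) := by
    have h : ∑ b : B, (blk b).card = ∑ v : Fin U × Fin M, Fintype.card {b // v ∈ blk b} := by
      have := Finset.sum_card_bipartiteAbove_eq_sum_card_bipartiteBelow
        (s := (Finset.univ : Finset B)) (t := (Finset.univ : Finset (Fin U × Fin M)))
        (fun b v => v ∈ blk b)
      simpa [Finset.bipartiteAbove, Finset.bipartiteBelow, Fintype.card_subtype] using this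
    simp only [h₁, hdeg] at h
    simpa [mul_comm K] using h
  obtain ⟨φ, hφ⟩ := hψ.combine blk h₂ h₃ hdeg
  have hM2 : (M * U + 1 : ℤ) = (((Q + 1) * T : ℕ) + 1) * (K - 1) := by
    push_cast
    linear_combination hM - hQU
  refine ⟨((Q + 1) * T : ℕ) + 1, hM2.symm, hφ.etfOfTypeExists (M := M * U) hK ?_ ?_ ?_ ?_⟩
  · zify
    push_cast at hM2
    linear_combination hM2
  · simp only [Fintype.card_sum, Fintype.card_prod, Fintype.card_fin]
    linear_combination hB + U * hD
  · simp only [Fintype.card_prod, Fintype.card_fin]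
    ring
  · simp only [Fintype.card_sum, Fintype.card_prod, Fintype.card_fin]
    nlinarith

open scoped Matrix

/-- The Steiner system of vectors of the affine plane over `F`. -/
theorem etfOfTypeExists_affine (F : Type) [Field F] [Fintype F] :
    ETFOfTypeExists (Fintype.card F + 2 : ℕ) (-1) (Fintype.card F + 1) := by
  classical
  set q := Fintype.card F with hq
  have hq2 : 2 ≤ q := Fintype.one_lt_card
  obtain ⟨h, h₁, h₂⟩ := exists_truncated_fourier (q + 1)
  let e : Option F ≃ Fin (q + 1) := Fintype.equivFinOfCardEq (by simp [hq])
  let line : F × F → Option F → F := fun p s => s.elim p.1 fun s => p.1 * s + p.2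
  have hline : ∀ p p', p ≠ p' → ∃! s, line p s = line p' s := by
    rintro ⟨a, b⟩ ⟨a', b'⟩ hne
    by_cases ha : a = a'
    · subst ha
      have hb : b ≠ b' := fun hb => hne (by rw [hb])
      refine ⟨none, rfl, ?_⟩
      rintro (_ | s) hs
      · rfl
      · exact absurd (add_left_cancel hs) hb
    · have ha' : a - a' ≠ 0 := sub_ne_zero.2 ha
      refine ⟨some ((b' - b) / (a - a')), ?_, ?_⟩
      · simp only [line, Option.elim]
        field_simp
        ring
      · rintro (_ | s) hs
        · exact absurd hs ha
        · simp only [line, Option.elim] at hs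
          rw [Option.some_inj, eq_div_iff ha']
          linear_combination hs
  let φ : (F × F) × Fin (q + 1 + 1) → Option F × F → ℂ := fun n k =>
    if line n.1 k.1 = k.2 then h n.2 (e k.1) else 0
  have hinner : ∀ n n', star (φ n) ⬝ᵥ φ n'
      = ∑ s, if line n.1 s = line n'.1 s then star (h n.2 (e s)) * h n'.2 (e s) else 0 := by
    intro n n'
    rw [dotProduct, Fintype.sum_prod_type]
    refine Finset.sum_congr rfl fun s _ => ?_
    rw [Finset.sum_eq_single (line n.1 s)]
    · by_cases hs : line n.1 s = line n'.1 s
      · simp [φ, hs]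
      · simp [φ, hs, Ne.symm hs]
    · intro t _ ht
      simp [φ, Ne.symm ht]
    · simp
  have hsame : ∀ p z z', star (φ (p, z)) ⬝ᵥ φ (p, z')
      = if z = z' then ((q + 1 : ℕ) : ℂ) else -1 := by
    intro p z z'
    rw [hinner, ← h₂, ← Equiv.sum_comp e]
    simp
  have hφ : IsUnimodularSystem (q + 1) φ := by
    constructor
    · rintro ⟨p, z⟩
      rw [hsame, if_pos rfl]
      push_cast
      ring
    · rintro ⟨p, z⟩ ⟨p', z'⟩ hne
      by_cases hp : p = p'
      · subst hp
        rw [hsame, if_neg fun hz => hne (by rw [hz])]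
        simp
      · obtain ⟨s, hs, hu⟩ := hline p p' hp
        rw [hinner, Finset.sum_eq_single s]
        · simp [hs, h₁]
        · intro t _ ht
          exact if_neg fun h' => ht (hu t h')
        · simp
  refine hφ.etfOfTypeExists (M := q * (q + 2)) (by omega) (by ring) ?_ ?_ ?_
  · simp only [Fintype.card_prod, Fintype.card_option, ← hq]
    ring
  · simp only [Fintype.card_prod, Fintype.card_fin, ← hq]
    ring
  · simp only [Fintype.card_prod, Fintype.card_option, ← hq]
    nlinarith

/-- The nine vectors of the Hesse configuration, in dimension three. -/
theorem etfOfTypeExists_hesse : ETFOfTypeExists 6 (-1) 2 := by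
  obtain ⟨h, h₁, h₂⟩ := exists_fourier 3
  have hunit : ∀ a b, star (h a b) * h a b = 1 := fun a b => by
    rw [Complex.star_def, Complex.conj_mul', h₁]; simp
  let φ : Fin 3 × Fin 3 → Fin 3 → ℂ := fun n x => if x = n.1 then 0 else h n.2 x
  have hsame : ∀ a b b', star (φ (a, b)) ⬝ᵥ φ (a, b')
      = (if b = b' then 3 else 0) - star (h b a) * h b' a := by
    intro a b b'
    have := h₂ b b'
    push_cast at this
    rw [← this, dotProduct, ← Finset.sum_erase_eq_sub (Finset.mem_univ a),
      ← Finset.sum_erase Finset.univ (a := a) (by simp [φ])]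
    exact Finset.sum_congr rfl fun x hx => by simp [φ, Finset.ne_of_mem_erase hx]
  have hthird : ∀ a a' : Fin 3, a ≠ a' → ∃ x, x ≠ a ∧ x ≠ a' ∧ ∀ y, y ≠ x → y = a ∨ y = a' := by
    decide
  have hφ : IsUnimodularSystem ((1 : ℕ) + 1) φ := by
    constructor
    · rintro ⟨a, b⟩
      rw [hsame, if_pos rfl, hunit]
      push_cast
      norm_num
    · rintro ⟨a, b⟩ ⟨a', b'⟩ hne
      by_cases ha : a = a'
      · subst ha
        rw [hsame, if_neg fun hb => hne (by rw [hb])]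
        simp [h₁]
      · obtain ⟨x, hx, hx', hu⟩ := hthird a a' ha
        rw [dotProduct, Finset.sum_eq_single x]
        · simp [φ, hx, hx', h₁]
        · intro y _ hy
          rcases hu y hy with rfl | rfl <;> simp [φ]
        · simp
  exact_mod_cast hφ.etfOfTypeExists (K := 6) (M := 9) (by norm_num) (by norm_num) (by simp)
    (by simp) (by simp)

/-- The signs of the Hadamard matrix of order eight whose entry at `(b, x)` is determined by the
parity of the number of binary digits that `b` and `x` share. -/
def hadamardSign (b x : Fin 8) : ℤ :=
  if Nat.testBit 150 (b.val &&& x.val) then -1 else 1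

/-- The 64 vectors of the Hoggar lines, in dimension eight. -/
theorem etfOfTypeExists_hoggar : ETFOfTypeExists 12 (-1) 3 := by
  have horth : ∀ b b', ∑ x, hadamardSign b x * hadamardSign b' x = if b = b' then 8 else 0 := by
    decide
  let c : ℂ := -1 + Complex.I
  let φ : Fin 8 × Fin 8 → Fin 8 → ℂ := fun n x =>
    hadamardSign n.2 x * (1 / 2 + if x = n.1 then c else 0)
  have hinner : ∀ n n', star (φ n) ⬝ᵥ φ n' = (if n.2 = n'.2 then 2 else 0)
      + star c / 2 * (hadamardSign n.2 n.1 * hadamardSign n'.2 n.1 : ℤ)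
      + c / 2 * (hadamardSign n.2 n'.1 * hadamardSign n'.2 n'.1 : ℤ)
      + if n.1 = n'.1 then 2 * ((hadamardSign n.2 n.1 * hadamardSign n'.2 n.1 : ℤ) : ℂ) else 0 := by
    rintro ⟨a, b⟩ ⟨a', b'⟩
    have hcc : star c * c = 2 := by
      simp only [c, Complex.star_def, map_add, map_neg, map_one, Complex.conj_I]
      ring_nf
      simp
      norm_num
    have hterm : ∀ x, star (φ (a, b) x) * φ (a', b') x
        = 1 / 4 * ((hadamardSign b x * hadamardSign b' x : ℤ) : ℂ)
        + (if x = a then star c / 2 * ((hadamardSign b x * hadamardSign b' x : ℤ) : ℂ) else 0)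
        + (if x = a' then c / 2 * ((hadamardSign b x * hadamardSign b' x : ℤ) : ℂ) else 0)
        + (if x = a then (if a = a' then
          2 * ((hadamardSign b x * hadamardSign b' x : ℤ) : ℂ) else 0) else 0) := by
      intro x
      have hs : star (φ (a, b) x)
          = hadamardSign b x * (1 / 2 + if x = a then star c else 0) := by
        simp only [φ, star_mul', star_add, apply_ite star, star_zero]
        simp
      rw [hs]
      simp only [φ]
      push_cast
      by_cases h₁ : x = a
      · subst h₁
        by_cases h₂ : x = a'
        · simp only [h₂, if_true]
          linear_combination (hadamardSign b a' : ℂ) * hadamardSign b' a' * hcc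
        · simp only [h₂, if_true, if_false]
          ring
      · by_cases h₂ : x = a'
        · subst h₂
          simp only [h₁, if_true, if_false]
          ring
        · simp only [h₁, h₂, if_false]
          ring
    simp only [dotProduct, Pi.star_apply]
    rw [Finset.sum_congr rfl fun x _ => hterm x]
    simp only [Finset.sum_add_distrib, Finset.sum_ite_eq', Finset.mem_univ, if_true,
      ← Finset.mul_sum, ← Int.cast_sum, horth]
    congr 3
    split_ifs <;> norm_num
  have hφ : IsUnimodularSystem ((2 : ℕ) + 1) φ := by
    have hsq : ∀ b x, hadamardSign b x * hadamardSign b x = 1 := by decide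
    have hre : star c / 2 + c / 2 = -1 := by
      simp only [c, Complex.star_def, map_add, map_neg, map_one, Complex.conj_I]
      ring
    have him : star c / 2 - c / 2 = -Complex.I := by
      simp only [c, Complex.star_def, map_add, map_neg, map_one, Complex.conj_I]
      ring
    have hprod : ∀ b b' x, hadamardSign b x * hadamardSign b' x = 1 ∨
        hadamardSign b x * hadamardSign b' x = -1 := by decide
    constructor
    · rintro ⟨a, b⟩
      rw [hinner]
      simp only [hsq, if_true]
      push_cast
      linear_combination hre
    · rintro ⟨a, b⟩ ⟨a', b'⟩ hne
      rw [hinner]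
      by_cases hb : b = b'
      · subst hb
        have ha : a ≠ a' := fun h => hne (by rw [h])
        simp only [hsq, if_true, if_neg ha]
        rw [show (2 : ℂ) + star c / 2 * ((1 : ℤ) : ℂ) + c / 2 * ((1 : ℤ) : ℂ) + 0 = 1 by
          push_cast; linear_combination hre]
        simp
      · simp only [if_neg hb]
        by_cases ha : a = a'
        · subst ha
          simp only [if_true]
          rw [show (0 : ℂ) + star c / 2 * ((hadamardSign b a * hadamardSign b' a : ℤ) : ℂ)
              + c / 2 * ((hadamardSign b a * hadamardSign b' a : ℤ) : ℂ)
              + 2 * ((hadamardSign b a * hadamardSign b' a : ℤ) : ℂ)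
              = ((hadamardSign b a * hadamardSign b' a : ℤ) : ℂ) by
            linear_combination ((hadamardSign b a * hadamardSign b' a : ℤ) : ℂ) * hre]
          rcases hprod b b' a with h | h <;> rw [h] <;> simp
        · simp only [if_neg ha]
          rcases hprod b b' a with h | h <;> rcases hprod b b' a' with h' | h' <;> rw [h, h']
          · rw [show (0 : ℂ) + star c / 2 * ((1 : ℤ) : ℂ) + c / 2 * ((1 : ℤ) : ℂ) + 0 = -1 by
              push_cast; linear_combination hre]
            simp
          · rw [show (0 : ℂ) + star c / 2 * ((1 : ℤ) : ℂ) + c / 2 * ((-1 : ℤ) : ℂ) + 0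
                = -Complex.I by push_cast; linear_combination him]
            simp
          · rw [show (0 : ℂ) + star c / 2 * ((-1 : ℤ) : ℂ) + c / 2 * ((1 : ℤ) : ℂ) + 0
                = Complex.I by push_cast; linear_combination -him]
            simp
          · rw [show (0 : ℂ) + star c / 2 * ((-1 : ℤ) : ℂ) + c / 2 * ((-1 : ℤ) : ℂ) + 0 = 1 by
              push_cast; linear_combination -hre]
            simp
  exact_mod_cast hφ.etfOfTypeExists (K := 12) (M := 32) (by norm_num) (by norm_num) (by simp)
    (by simp) (by simp)

theorem UniformGDDExists.pos {K M U : ℕ} (h : UniformGDDExists K M U) : 0 < U := by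
  obtain ⟨V, hV, hdec, groups, blocks, hG, rfl, -⟩ := h
  rw [Finset.card_pos, Finset.nonempty_iff_ne_empty]
  intro h0
  have := Finpartition.parts_eq_empty_iff.1 h0
  have hlt := hG.lt_card
  rw [← Finset.card_univ, this] at hlt
  simp at hlt

theorem GroupDivisibleExists.exists_etf {K M U : ℕ} {S : ℤ}
    (hG : GroupDivisibleExists K (Fin U) (Fin M)) (hU : 0 < U) (hE : ETFOfTypeExists K (-1) S)
    (hdvd : (S - 1) ∣ ((K : ℤ) - 2)) (hM : (M : ℤ) = S * ((K : ℤ) - 1) - 1) :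
    ∃ S' : ℤ, (S' : ℚ) = ((M : ℚ) * U + 1) / ((K : ℚ) - 1) ∧ ETFOfTypeExists K (-1) S' := by
  obtain ⟨S', h, hE'⟩ := hG.etfOfTypeExists hU hE hdvd hM
  have hK : (2 : ℚ) ≤ K := by exact_mod_cast hE.exists_isUnimodularSystem.1
  refine ⟨S', ?_, hE'⟩
  rw [eq_div_iff (by linarith)]
  exact_mod_cast h

theorem exists_etf_of_orthogonalArrays {K M : ℕ} {S : ℤ} (hE : ETFOfTypeExists K (-1) S)
    (hdvd : (S - 1) ∣ ((K : ℤ) - 2)) (hM : (M : ℤ) = S * ((K : ℤ) - 1) - 1)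
    (hTD : ∀ j, OrthogonalArrayExists (Fin K) (Fin (M * K ^ j))) {U : ℕ}
    (hU : (∃ J : ℕ, U = K ^ J) ∨ BIBDExists U K) :
    ∃ S' : ℤ, (S' : ℚ) = ((M : ℚ) * U + 1) / ((K : ℚ) - 1) ∧ ETFOfTypeExists K (-1) S' := by
  have hK := hE.exists_isUnimodularSystem.1
  rcases hU with ⟨J, rfl⟩ | hU
  · exact (GroupDivisibleExists.of_pow fun j _ => .of_orthogonalArray (hTD j)).exists_etf
      (by positivity) hE hdvd hM
  · exact ((GroupDivisibleExists.of_uniform hU).inflate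
      (.of_orthogonalArray (by simpa using hTD 0))).exists_etf (UniformGDDExists.pos hU) hE hdvd hM

namespace OrthogonalArrayExists

theorem of_primePow_mul {k p a q b n : ℕ} (hp : p.Prime) (hq : q.Prime) (ha : a ≠ 0) (hb : b ≠ 0)
    (hpk : k ≤ p ^ a + 1) (hqk : k ≤ q ^ b + 1) (hn : n = p ^ a * q ^ b) :
    OrthogonalArrayExists (Fin k) (Fin n) :=
  hn ▸ (of_primePow hp ha hpk).mul (of_primePow hq hb hqk)

theorem of_order_54 : OrthogonalArrayExists (Fin 6) (Fin 54) :=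
  wilson_fin (t := 7) (m := 7) (u := 5) (by norm_num) (by norm_num)
    (of_prime (by norm_num) (by norm_num)) (of_prime (by norm_num) (by norm_num))
    (of_primePow (p := 2) (n := 3) (by norm_num) (by norm_num) (by norm_num))
    (of_prime (by norm_num) (by norm_num))

theorem of_order_384 : OrthogonalArrayExists (Fin 12) (Fin 384) :=
  wilson_fin (t := 23) (m := 16) (u := 16) (by norm_num) (by norm_num)
    (of_prime (by norm_num) (by norm_num))
    (of_primePow (p := 2) (n := 4) (by norm_num) (by norm_num) (by norm_num))
    (of_prime (by norm_num) (by norm_num))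
    (of_primePow (p := 2) (n := 4) (by norm_num) (by norm_num) (by norm_num))

theorem of_order_4608 : OrthogonalArrayExists (Fin 12) (Fin 4608) :=
  wilson_fin (t := 277) (m := 16) (u := 176) (by norm_num) (by norm_num)
    (of_prime (by norm_num) (by norm_num))
    (of_primePow (p := 2) (n := 4) (by norm_num) (by norm_num) (by norm_num))
    (of_prime (by norm_num) (by norm_num))
    (of_primePow_mul (p := 2) (a := 4) (q := 11) (b := 1) (by norm_num) (by norm_num)
      (by norm_num) (by norm_num) (by norm_num) (by norm_num) (by norm_num))

theorem of_nine_mul_six_pow : ∀ j, OrthogonalArrayExists (Fin 6) (Fin (9 * 6 ^ j))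
  | 0 => of_primePow (p := 3) (n := 2) (by norm_num) (by norm_num) (by norm_num)
  | 1 => of_order_54
  | 2 => (of_order_12.mul (of_primePow (p := 3) (n := 3) (by norm_num) (by norm_num)
      (by norm_num)) : OrthogonalArrayExists (Fin 6) (Fin (12 * 27)))
  | j + 3 => of_primePow_mul (p := 2) (a := j + 3) (q := 3) (b := j + 5) Nat.prime_two
      Nat.prime_three (by omega) (by omega)
      (by have := Nat.one_le_two_pow (n := j); rw [pow_add]; omega)
      (by have := Nat.one_le_pow j 3 (by norm_num); rw [pow_add]; omega)
      (by rw [show 6 = 2 * 3 by norm_num, mul_pow]; ring)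

theorem of_twentyFour_mul_six_pow : ∀ j, OrthogonalArrayExists (Fin 6) (Fin (24 * 6 ^ j))
  | 0 => of_order_24
  | j + 1 => of_primePow_mul (p := 2) (a := j + 4) (q := 3) (b := j + 2) Nat.prime_two
      Nat.prime_three (by omega) (by omega)
      (by have := Nat.one_le_two_pow (n := j); rw [pow_add]; omega)
      (by have := Nat.one_le_pow j 3 (by norm_num); rw [pow_add]; omega)
      (by rw [show 6 = 2 * 3 by norm_num, mul_pow]; ring)

theorem of_thirtyFive_mul_seven_pow : ∀ j, OrthogonalArrayExists (Fin 7) (Fin (35 * 7 ^ j))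
  | 0 => of_order_35
  | j + 1 => of_order_35.mul (of_primePow (p := 7) (n := j + 1) (by norm_num) (by omega)
      (by have := Nat.one_le_pow j 7 (by norm_num); rw [pow_add]; omega))

theorem of_eighty_mul_ten_pow : ∀ j, OrthogonalArrayExists (Fin 10) (Fin (80 * 10 ^ j))
  | 0 => of_order_80
  | j + 1 => of_primePow_mul (p := 2) (a := j + 5) (q := 5) (b := j + 2) Nat.prime_two
      Nat.prime_five (by omega) (by omega)
      (by have := Nat.one_le_two_pow (n := j); rw [pow_add]; omega)
      (by have := Nat.one_le_pow j 5 (by norm_num); rw [pow_add]; omega)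
      (by rw [show 10 = 2 * 5 by norm_num, mul_pow]; ring)

theorem of_thirtyTwo_mul_twelve_pow : ∀ j, OrthogonalArrayExists (Fin 12) (Fin (32 * 12 ^ j))
  | 0 => of_primePow (p := 2) (n := 5) (by norm_num) (by norm_num) (by norm_num)
  | 1 => of_order_384
  | 2 => of_order_4608
  | j + 3 => of_primePow_mul (p := 2) (a := 2 * j + 11) (q := 3) (b := j + 3) Nat.prime_two
      Nat.prime_three (by omega) (by omega)
      (by have := Nat.one_le_two_pow (n := 2 * j); rw [pow_add]; omega)
      (by have := Nat.one_le_pow j 3 (by norm_num); rw [pow_add]; omega)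
      (by rw [show 12 = 2 ^ 2 * 3 by norm_num, mul_pow, ← pow_mul]; ring)

end OrthogonalArrayExists

theorem etfOfTypeExists_primePow {p n : ℕ} (hp : p.Prime) (hn : n ≠ 0) :
    ETFOfTypeExists (p ^ n + 2 : ℕ) (-1) ((p ^ n : ℕ) + 1) := by
  have := Fact.mk hp
  have : Fintype (GaloisField p n) := Fintype.ofFinite _
  have hc : Fintype.card (GaloisField p n) = p ^ n := by
    rw [← Nat.card_eq_fintype_card, GaloisField.card p n hn]
  have h := etfOfTypeExists_affine (GaloisField p n)
  rwa [hc] at h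

theorem theorem4p4 :
    (∀ (K M : ℕ) (S : ℤ),
      ETFOfTypeExists K (-1) S → (S - 1) ∣ ((K : ℤ) - 2) →
      (M : ℤ) = S * ((K : ℤ) - 1) - 1 → TDExists K M →
      ∀ U : ℕ,
        ((U = 1 ∨ U = K) ∨
          BIBDExists U K ∨
          (∃ J : ℕ, 2 ≤ J ∧ U = K ^ J ∧ ∀ j : ℕ, 1 ≤ j → j < J → TDExists K (M * K ^ j))) →
        ∃ S' : ℤ, (S' : ℚ) = ((M : ℚ) * U + 1) / ((K : ℚ) - 1) ∧ ETFOfTypeExists K (-1) S') ∧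
    (∀ U : ℕ, ((∃ J : ℕ, U = 6 ^ J) ∨ BIBDExists U 6) →
      ∃ S : ℤ, (S : ℚ) = (9 * (U : ℚ) + 1) / 5 ∧ ETFOfTypeExists 6 (-1) S) ∧
    (∀ U : ℕ, ((∃ J : ℕ, U = 6 ^ J) ∨ BIBDExists U 6) →
      ∃ S : ℤ, (S : ℚ) = (24 * (U : ℚ) + 1) / 5 ∧ ETFOfTypeExists 6 (-1) S) ∧
    (∀ U : ℕ, ((∃ J : ℕ, U = 7 ^ J) ∨ BIBDExists U 7) →
      ∃ S : ℤ, (S : ℚ) = (35 * (U : ℚ) + 1) / 6 ∧ ETFOfTypeExists 7 (-1) S) ∧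
    (∀ U : ℕ, ((∃ J : ℕ, U = 10 ^ J) ∨ BIBDExists U 10) →
      ∃ S : ℤ, (S : ℚ) = (80 * (U : ℚ) + 1) / 9 ∧ ETFOfTypeExists 10 (-1) S) ∧
    (∀ U : ℕ, ((∃ J : ℕ, U = 12 ^ J) ∨ BIBDExists U 12) →
      ∃ S : ℤ, (S : ℚ) = (32 * (U : ℚ) + 1) / 11 ∧ ETFOfTypeExists 12 (-1) S) := by
  refine ⟨fun K M S hE hdvd hM hTD U hU => ?_, fun U hU => ?_, fun U hU => ?_, fun U hU => ?_,
    fun U hU => ?_, fun U hU => ?_⟩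
  · have hK := hE.exists_isUnimodularSystem.1
    have hG := GroupDivisibleExists.of_uniform hTD
    rcases hU with (rfl | rfl) | hU | ⟨J, -, rfl, hJ⟩
    · exact (GroupDivisibleExists.of_subsingleton K (Fin 1) (Fin M)).exists_etf one_pos hE hdvd hM
    · exact hG.exists_etf (by omega) hE hdvd hM
    · exact ((GroupDivisibleExists.of_uniform hU).inflate hG).exists_etf
        (UniformGDDExists.pos hU) hE hdvd hM
    · refine (GroupDivisibleExists.of_pow fun j hj => ?_).exists_etf (by positivity) hE hdvd hM
      rcases Nat.eq_zero_or_pos j with rfl | h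
      · simpa using hG
      · exact .of_uniform (hJ j h hj)
  · obtain ⟨S, h, hE⟩ := exists_etf_of_orthogonalArrays (K := 6) (M := 9) etfOfTypeExists_hesse
      (by norm_num) (by norm_num) OrthogonalArrayExists.of_nine_mul_six_pow hU
    exact ⟨S, by rw [h]; norm_num, hE⟩
  · obtain ⟨S, h, hE⟩ := exists_etf_of_orthogonalArrays (K := 6) (M := 24)
      (etfOfTypeExists_primePow (p := 2) (n := 2) Nat.prime_two two_ne_zero)
      (by norm_num) (by norm_num) OrthogonalArrayExists.of_twentyFour_mul_six_pow hU
    exact ⟨S, by rw [h]; norm_num, hE⟩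
  · obtain ⟨S, h, hE⟩ := exists_etf_of_orthogonalArrays (K := 7) (M := 35)
      (etfOfTypeExists_primePow (p := 5) (n := 1) Nat.prime_five one_ne_zero)
      (by norm_num) (by norm_num) OrthogonalArrayExists.of_thirtyFive_mul_seven_pow hU
    exact ⟨S, by rw [h]; norm_num, hE⟩
  · obtain ⟨S, h, hE⟩ := exists_etf_of_orthogonalArrays (K := 10) (M := 80)
      (etfOfTypeExists_primePow (p := 2) (n := 3) Nat.prime_two three_ne_zero)
      (by norm_num) (by norm_num) OrthogonalArrayExists.of_eighty_mul_ten_pow hU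
    exact ⟨S, by rw [h]; norm_num, hE⟩
  · obtain ⟨S, h, hE⟩ := exists_etf_of_orthogonalArrays (K := 12) (M := 32) etfOfTypeExists_hoggar
      (by norm_num) (by norm_num) OrthogonalArrayExists.of_thirtyTwo_mul_twelve_pow hU
    exact ⟨S, by rw [h]; norm_num, hE⟩
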